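/- Let $\phi(s)=s-1-\ln s$ with the principal branch of the logarithm. A contour $\gamma$ is called admissible if (i) $\gamma$ is a smooth (regular $C^1$) Jordan curve winding once counterclockwise around the origin, and (ii) there is an open neighbourhood $U$ of $1$ such that $\gamma\cap U$ coincides with $\{s\in U\setminus\{0\}:\operatorname{Im}\phi(s)=0,\ \operatorname{Re}\phi(s)\le 0\}$ (the path of steepest descent through the critical point $1$ of $\phi$), while $\gamma\setminus U$ has a positive distance from the curve $\{s\ne 0:\operatorname{Re}\phi(s)=0\}$. For $n\in\mathbb N$ and $z\in\mathbb C\setminus\gamma$ put $$F_n(z)=\frac1{2\pi i}\int_\gamma\frac{s^{-n}e^{n(s-1)}}{s-z}\,ds .$$ There exist polynomials $h_j$ ($j\ge 1$) of degree exactly $2j$, not depending on $\gamma$, with $h_1(z)=-\frac1{12}(z^2+10z+1)$, such that for every admissible contour $\gamma$ and every integer $r\ge 1$ the following holds. (a) For every $\varepsilon>0$, as $n\to\infty$, $$F_n(z)=\frac{1}{\sqrt{2\pi n}\,(1-z)}\left(1+\sum_{j=1}^{r-1}\frac{h_j(z)}{n^j(z-1)^{2j}}+O\!\left(\frac1{n^r}\right)\right),$$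 where the error term is uniform for $z\in\mathbb C\setminus\gamma$ with $\varepsilon\le|z-1|\le 2$ (the implied constant depends only on $\gamma$, $r$, $\varepsilon$). (b) For every fixed $0<\alpha<\frac12$, the same expansion, with the same polynomials $h_j$, holds as $n\to\infty$ for $z\in\mathbb C\setminus\gamma$ with $n^{-\alpha}\le|z-1|\le2$, with the error term replaced by $O\!\left(\frac{1}{n^r|1-z|^{2r}}\right)$, uniformly in $z$ (the implied constant depends only on $\gamma$, $r$, $\alpha$). -/

import Mathlib

open Complex Set Topology

noncomputable section

/-- `φ(s) = s - 1 - ln s`, with the principal branch of the logarithm. -/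
def phase (s : ℂ) : ℂ := s - 1 - Complex.log s

/-- The contour integral `∫_γ f(s) ds` along a closed curve parametrized by one period `[0, 1]`. -/
def contourInt (γ : ℝ → ℂ) (f : ℂ → ℂ) : ℂ :=
  ∫ t in (0 : ℝ)..1, f (γ t) * deriv γ t

/-- A smooth Jordan curve, as a 1-periodic continuously differentiable map with nowhere vanishing
derivative that is injective on one period. -/
structure IsSmoothJordanCurve (γ : ℝ → ℂ) : Prop where
  periodic : Function.Periodic γ 1
  contDiff : ContDiff ℝ 1 γ
  deriv_ne_zero : ∀ t, deriv γ t ≠ 0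
  injOn : InjOn γ (Ico 0 1)

/-- The curve winds counterclockwise around the origin: it avoids the origin, and its winding
number about the origin is `+1`. -/
def WindsCounterclockwiseAroundZero (γ : ℝ → ℂ) : Prop :=
  (0 : ℂ) ∉ range γ ∧ (2 * (Real.pi : ℂ) * I)⁻¹ * contourInt γ (fun s => s⁻¹) = 1

/-- The level set `Re φ = 0` through the critical point `1`. -/
def levelCurve : Set ℂ := {s | s ≠ 0 ∧ (phase s).re = 0}

/-- The path of steepest descent of `Re φ` from the critical point `1`: there `Im φ = 0`
(that is, `arg s = Im s`) and `Re φ ≤ 0`; the second condition rules out the other points of the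
positive real axis, along which `Re φ` increases away from `1`. -/
def steepestDescentPath : Set ℂ := {s | s ≠ 0 ∧ (phase s).im = 0 ∧ (phase s).re ≤ 0}

/-- Admissible contours: smooth Jordan curves winding counterclockwise around the origin that
coincide with the path of steepest descent in some neighbourhood `U` of `1`, and whose part
outside `U` has a positive distance from the level curve `Re φ = 0`. -/
structure IsAdmissible (γ : ℝ → ℂ) : Prop where
  jordan : IsSmoothJordanCurve γ
  winding : WindsCounterclockwiseAroundZero γ
  descent : ∃ U : Set ℂ, IsOpen U ∧ (1 : ℂ) ∈ U ∧
    range γ ∩ U = steepestDescentPath ∩ U ∧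
    ∃ δ : ℝ, 0 < δ ∧ ∀ s ∈ range γ \ U, ∀ w ∈ levelCurve, δ ≤ dist s w

/-- `F_n(z) = (2πi)⁻¹ ∫_γ s^{-n} e^{n(s-1)} / (s - z) ds`, for `z` off the curve `γ`. -/
def cauchyF (γ : ℝ → ℂ) (n : ℕ) (z : ℂ) : ℂ :=
  (2 * (Real.pi : ℂ) * I)⁻¹ *
    contourInt γ (fun s => (s ^ n)⁻¹ * Complex.exp ((n : ℂ) * (s - 1)) / (s - z))

/-- The expansion `(1 / (√(2πn) (1 - z))) (1 + ∑_{j=1}^{r-1} h_j(z) / (n^j (z-1)^{2j}) + E)`,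
with `E` in the place of the error term. -/
def expansion (h : ℕ → Polynomial ℂ) (r n : ℕ) (z E : ℂ) : ℂ :=
  1 / ((Real.sqrt (2 * Real.pi * n) : ℂ) * (1 - z)) *
    (1 + ∑ j ∈ Finset.Ico 1 r, (h j).eval z / ((n : ℂ) ^ j * (z - 1) ^ (2 * j)) + E)

end

/-! Write `u = 1 - z`, `v = s - 1` and expand `1/(s - z) = 1/(u + v)` as a finite geometric sum of
`2r` terms with exact remainder (`inv_add_eq_sum`, `cauchyF_eq`). The terms involve only the moments
of `s^(-n) e^(n(s-1))` against `(s-1)^m`; the whole `z`-dependence sits in powers of `u`.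

The moments are exact, so no saddle point analysis is needed for them. The zeroth is a residue, `n^n
e^(-n)/n!`, and integration by parts gives a three-term recurrence for the others
(`contourMoment_succ`). After multiplication by `√(2πn)` their expansions in `1/n` all follow from
the Stirling series of `1/n!` (`stirlingQuot_expansion`), proved from the ratio of consecutive terms
by telescoping. The `m`-th moment starts at order `n^(-⌈m/2⌉)` or later, so collecting powers of
`1/n` yields polynomials of degree at most `2j`. Their leading coefficient is the `j`-th Stirling
coefficient; it is nonzero because it becomes a 2-adic unit after multiplication by `4^j j!`
(`stirlingCoeff_ne_zero`).

The remainder carries `(s-1)^(2r)/(s-z)` and must be bounded uniformly as `z` approaches the contour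
(`norm_contourInt_remainder_le`). Admissibility gives `Re φ ≤ -c|s-1|²` on all of `γ`, so the kernel
is dominated by a Gaussian. If `z` is at distance comparable to `|z-1|` from `γ`, the absolute
integral suffices. Otherwise the value of the numerator at `z` is subtracted on a short arc; the
difference quotient is controlled by a derivative bound, and the integral of `1/(s-z)` by a
logarithm.

The resulting error `O(n^(-r)|1-z|^(-2r))` holds for every `z ≠ 1` off the contour with `|z-1| ≤ 2`,
and gives both parts. -/

/-! ### Taylor coefficients of real analytic functions. -/

/-- The formal Taylor series at `0` of a real function. -/
noncomputable def taylorSeries (f : ℝ → ℝ) : PowerSeries ℝ :=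
  PowerSeries.mk fun k => iteratedDeriv k f 0 / k.factorial

theorem coeff_taylorSeries (f : ℝ → ℝ) (k : ℕ) :
    PowerSeries.coeff k (taylorSeries f) = iteratedDeriv k f 0 / k.factorial := by
  simp [taylorSeries]

theorem taylorSeries_congr {f g : ℝ → ℝ} (h : f =ᶠ[𝓝 0] g) : taylorSeries f = taylorSeries g := by
  ext k
  rw [coeff_taylorSeries, coeff_taylorSeries, h.iteratedDeriv_eq]

theorem taylorSeries_mul {f g : ℝ → ℝ} (hf : AnalyticAt ℝ f 0) (hg : AnalyticAt ℝ g 0) :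
    taylorSeries (fun x => f x * g x) = taylorSeries f * taylorSeries g := by
  ext k
  rw [coeff_taylorSeries, PowerSeries.coeff_mul]
  have := iteratedDeriv_mul (n := k) hf.contDiffAt hg.contDiffAt
  rw [show (fun x => f x * g x) = f * g from rfl, this,
    Finset.Nat.sum_antidiagonal_eq_sum_range_succ
      (fun i j => PowerSeries.coeff i (taylorSeries f) * PowerSeries.coeff j (taylorSeries g)),
    Finset.sum_div]
  refine Finset.sum_congr rfl fun i hi => ?_
  have hik : i ≤ k := Nat.lt_succ_iff.mp (Finset.mem_range.mp hi)
  rw [coeff_taylorSeries, coeff_taylorSeries, Nat.cast_choose ℝ hik]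
  have h1 : (k.factorial : ℝ) ≠ 0 := by positivity
  field_simp

theorem taylorSeries_add {f g : ℝ → ℝ} (hf : AnalyticAt ℝ f 0) (hg : AnalyticAt ℝ g 0) :
    taylorSeries (fun x => f x + g x) = taylorSeries f + taylorSeries g := by
  ext k
  rw [map_add, coeff_taylorSeries, coeff_taylorSeries, coeff_taylorSeries,
    show (fun x => f x + g x) = f + g from rfl, iteratedDeriv_add hf.contDiffAt hg.contDiffAt,
    add_div]

theorem taylorSeries_const (c : ℝ) : taylorSeries (fun _ => c) = PowerSeries.C c := by
  ext k
  rw [coeff_taylorSeries, iteratedDeriv_const, PowerSeries.coeff_C]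
  split_ifs with h <;> simp [h]

theorem coeff_taylorSeries_deriv (f : ℝ → ℝ) (k : ℕ) :
    PowerSeries.coeff k (taylorSeries (deriv f)) =
      (k + 1) * PowerSeries.coeff (k + 1) (taylorSeries f) := by
  rw [coeff_taylorSeries, coeff_taylorSeries, iteratedDeriv_succ', Nat.factorial_succ]
  push_cast
  field_simp

theorem taylorSeries_id : taylorSeries (fun x => x) = PowerSeries.X := by
  ext k
  cases k with
  | zero => simp [coeff_taylorSeries]
  | succ k =>
    have h := coeff_taylorSeries_deriv (fun x : ℝ => x) k
    rw [show deriv (fun x : ℝ => x) = fun _ => 1 by ext; simp, taylorSeries_const,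
      PowerSeries.coeff_C] at h
    rw [PowerSeries.coeff_X]
    rcases Nat.eq_zero_or_pos k with rfl | hk
    · simpa using h.symm
    · rw [if_neg hk.ne'] at h
      rw [if_neg (by lia)]
      exact (mul_eq_zero.mp h.symm).resolve_left (by positivity)

theorem taylorSeries_pow {f : ℝ → ℝ} (hf : AnalyticAt ℝ f 0) (k : ℕ) :
    taylorSeries (fun x => f x ^ k) = taylorSeries f ^ k := by
  induction k with
  | zero => simpa using taylorSeries_const 1
  | succ k ih =>
    simp_rw [pow_succ]
    rw [taylorSeries_mul (hf.fun_pow k) hf, ih]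

theorem taylorSeries_sum {ι : Type*} (s : Finset ι) {f : ι → ℝ → ℝ}
    (hf : ∀ i ∈ s, AnalyticAt ℝ (f i) 0) :
    taylorSeries (fun x => ∑ i ∈ s, f i x) = ∑ i ∈ s, taylorSeries (f i) := by
  classical
  induction s using Finset.induction_on with
  | empty => simpa using taylorSeries_const 0
  | insert a s ha ih =>
    simp_rw [Finset.sum_insert ha]
    rw [taylorSeries_add (hf a (by simp))
      (Finset.analyticAt_fun_sum s fun i hi => hf i (by simp [hi])),
      ih fun i hi => hf i (by simp [hi])]

theorem isBigO_of_coeff_taylorSeries_eq_zero {f : ℝ → ℝ} (hf : AnalyticAt ℝ f 0) {N : ℕ}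
    (h : ∀ k < N, PowerSeries.coeff k (taylorSeries f) = 0) :
    f =O[𝓝 0] fun x => x ^ N := by
  have := hf.hasFPowerSeriesAt.isBigO_sub_partialSum_pow N
  simp only [zero_add] at this
  have h2 : ∀ y, (FormalMultilinearSeries.ofScalars ℝ
      (fun n ↦ iteratedDeriv n f 0 / (n.factorial : ℝ))).partialSum N y = 0 := by
    intro y
    rw [FormalMultilinearSeries.partialSum]
    refine Finset.sum_eq_zero fun k hk => ?_
    have := h k (Finset.mem_range.mp hk)
    rw [coeff_taylorSeries] at this
    simp [FormalMultilinearSeries.ofScalars, this]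
  simp only [h2, sub_zero] at this
  refine this.trans ?_
  refine Asymptotics.IsBigO.of_norm_right ?_
  simpa using Asymptotics.isBigO_refl _ _

/-! ### The ratio of consecutive Stirling quotients and its Taylor coefficients. -/

/-- `log (1 + x) / x`, continued analytically to `0`. -/
noncomputable def logQuot : ℝ → ℝ := dslope (fun x => Real.log (1 + x)) 0

/-- The factor `(1 + x) ^ (1 / x + 1 / 2) / e`, continued analytically to `0`. -/
noncomputable def stirlingRatio (x : ℝ) : ℝ := Real.exp ((1 + x * (1 / 2)) * logQuot x + -1)

theorem analyticAt_log_one_add : AnalyticAt ℝ (fun x => Real.log (1 + x)) 0 := by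
  refine AnalyticAt.log (by fun_prop) (by simp)

theorem analyticAt_logQuot : AnalyticAt ℝ logQuot 0 :=
  (analyticAt_log_one_add.hasFPowerSeriesAt.has_fpower_series_dslope_fslope).analyticAt

theorem mul_logQuot (x : ℝ) : x * logQuot x = Real.log (1 + x) := by
  have := sub_smul_dslope (fun x => Real.log (1 + x)) 0 x
  simpa [logQuot] using this

theorem taylorSeries_one_add_inv :
    taylorSeries (fun x => (1 + x)⁻¹) = PowerSeries.mk fun k => (-1) ^ k := by
  have hA : AnalyticAt ℝ (fun x : ℝ => 1 + x) 0 := by fun_prop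
  have hB : AnalyticAt ℝ (fun x : ℝ => (1 + x)⁻¹) 0 := hA.fun_inv (by simp)
  have h1 : taylorSeries (fun x => (1 + x) * (1 + x)⁻¹) = 1 := by
    rw [taylorSeries_congr (g := fun _ => 1), taylorSeries_const, map_one]
    have : ∀ᶠ x : ℝ in 𝓝 0, 1 + x ≠ 0 :=
      hA.continuousAt.eventually_ne (by simp)
    filter_upwards [this] with x hx
    exact mul_inv_cancel₀ hx
  rw [taylorSeries_mul hA hB, taylorSeries_add (by fun_prop) (by fun_prop), taylorSeries_const,
    taylorSeries_id, map_one] at h1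
  have h2 : (1 + PowerSeries.X : PowerSeries ℝ) * PowerSeries.mk (fun k => (-1) ^ k) = 1 := by
    ext k
    rw [add_mul, one_mul, map_add]
    cases k with
    | zero => simp
    | succ k => rw [PowerSeries.coeff_succ_X_mul]; simp [pow_succ, PowerSeries.coeff_one]
  calc _ = taylorSeries (fun x => (1 + x)⁻¹) *
        ((1 + PowerSeries.X : PowerSeries ℝ) * PowerSeries.mk (fun k => (-1) ^ k)) := by
        rw [h2, mul_one]
    _ = ((1 + PowerSeries.X : PowerSeries ℝ) * taylorSeries (fun x => (1 + x)⁻¹)) *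
        PowerSeries.mk (fun k => (-1) ^ k) := by ring
    _ = _ := by rw [h1, one_mul]

theorem coeff_logQuot (k : ℕ) :
    PowerSeries.coeff k (taylorSeries logQuot) = (-1) ^ k / (k + 1) := by
  have h1 := coeff_taylorSeries_deriv (fun x => Real.log (1 + x)) k
  rw [taylorSeries_congr (g := fun x => (1 + x)⁻¹), taylorSeries_one_add_inv,
    PowerSeries.coeff_mk] at h1
  · have h2 : taylorSeries (fun x => x * logQuot x) = PowerSeries.X * taylorSeries logQuot := by
      rw [taylorSeries_mul (by fun_prop) analyticAt_logQuot, taylorSeries_id]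
    simp_rw [mul_logQuot] at h2
    rw [h2, PowerSeries.coeff_succ_X_mul] at h1
    rw [h1]; field_simp
  · have : ∀ᶠ x : ℝ in 𝓝 0, 1 + x ≠ 0 :=
      (show ContinuousAt (fun x : ℝ => 1 + x) 0 by fun_prop).eventually_ne (by simp)
    filter_upwards [this] with x hx
    have h3 := (Real.hasDerivAt_log hx).comp_const_add 1 x
    exact h3.deriv

theorem analyticAt_stirlingExponent :
    AnalyticAt ℝ (fun x => (1 + x * (1 / 2)) * logQuot x + -1) 0 :=
  ((by fun_prop : AnalyticAt ℝ (fun x : ℝ => 1 + x * (1 / 2)) 0).fun_mul analyticAt_logQuot).fun_add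
    (by fun_prop)

theorem coeff_deriv_stirlingExponent (i : ℕ) :
    PowerSeries.coeff i (taylorSeries (deriv fun x => (1 + x * (1 / 2)) * logQuot x + -1)) =
      (-1) ^ (i + 1) * (i / (2 * (i + 2))) := by
  have hA : AnalyticAt ℝ (fun x : ℝ => 1 + x * (1 / 2)) 0 := by fun_prop
  rw [coeff_taylorSeries_deriv, taylorSeries_add (hA.fun_mul analyticAt_logQuot) (by fun_prop),
    taylorSeries_mul hA analyticAt_logQuot, taylorSeries_add (by fun_prop) (by fun_prop),
    taylorSeries_mul (by fun_prop) (by fun_prop), taylorSeries_id, taylorSeries_const,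
    taylorSeries_const, taylorSeries_const, map_one,
    show (1 + PowerSeries.X * PowerSeries.C (1 / 2 : ℝ)) * taylorSeries logQuot +
      PowerSeries.C (-1) = taylorSeries logQuot + PowerSeries.X * (PowerSeries.C (1 / 2) *
      taylorSeries logQuot) + PowerSeries.C (-1) by ring,
    map_add, map_add, PowerSeries.coeff_succ_X_mul, PowerSeries.coeff_C_mul, coeff_logQuot,
    coeff_logQuot, PowerSeries.coeff_C]
  simp only [Nat.succ_ne_zero, if_false]
  push_cast
  field_simp
  ring

theorem analyticAt_stirlingRatio : AnalyticAt ℝ stirlingRatio 0 :=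
  analyticAt_stirlingExponent.rexp

/-- The Taylor coefficients of `stirlingRatio`. -/
noncomputable def ratioCoeff (k : ℕ) : ℝ := PowerSeries.coeff k (taylorSeries stirlingRatio)

/-- Logarithmic differentiation: `ρ' = ψ' ρ` for `ρ = exp ψ`, read off coefficientwise. -/
theorem ratioCoeff_succ (m : ℕ) :
    (m + 1) * ratioCoeff (m + 1) = ∑ i ∈ Finset.range (m + 1),
      (-1) ^ (i + 1) * (i / (2 * (i + 2))) * ratioCoeff (m - i) := by
  have h := coeff_taylorSeries_deriv stirlingRatio m
  rw [ratioCoeff, ← h, taylorSeries_congr (g := fun x =>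
    deriv (fun x => (1 + x * (1 / 2)) * logQuot x + -1) x * stirlingRatio x),
    taylorSeries_mul analyticAt_stirlingExponent.deriv analyticAt_stirlingRatio,
    PowerSeries.coeff_mul, Finset.Nat.sum_antidiagonal_eq_sum_range_succ
      (fun i j => PowerSeries.coeff i (taylorSeries _) * PowerSeries.coeff j (taylorSeries _))]
  · simp_rw [coeff_deriv_stirlingExponent]
    rfl
  · filter_upwards [analyticAt_stirlingExponent.eventually_analyticAt] with x hx
    have := hx.differentiableAt.hasDerivAt.exp.deriv
    rw [mul_comm]
    exact this

theorem ratioCoeff_zero : ratioCoeff 0 = 1 := by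
  have h := coeff_logQuot 0
  rw [coeff_taylorSeries] at h
  simp at h
  simp [ratioCoeff, coeff_taylorSeries, stirlingRatio, h]

theorem ratioCoeff_one : ratioCoeff 1 = 0 := by
  have := ratioCoeff_succ 0
  simpa using this

theorem ratioCoeff_two : ratioCoeff 2 = 1 / 12 := by
  have := ratioCoeff_succ 1
  simp [Finset.sum_range_succ, ratioCoeff_zero] at this
  linarith

/-! ### 2-adic arithmetic and the nonvanishing of the Stirling coefficients. -/

/-- The rational numbers with odd denominator, inside `ℝ`. -/
def oddDenominators : Subring ℝ where
  carrier := {x | ∃ a b : ℤ, Odd b ∧ x * b = a}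
  mul_mem' := by
    rintro x y ⟨a, b, hb, h⟩ ⟨a', b', hb', h'⟩
    exact ⟨a * a', b * b', hb.mul hb', by push_cast; rw [← h, ← h']; ring⟩
  one_mem' := ⟨1, 1, odd_one, by simp⟩
  add_mem' := by
    rintro x y ⟨a, b, hb, h⟩ ⟨a', b', hb', h'⟩
    exact ⟨a * b' + a' * b, b * b', hb.mul hb', by push_cast; rw [← h, ← h']; ring⟩
  zero_mem' := ⟨0, 1, odd_one, by simp⟩
  neg_mem' := by
    rintro x ⟨a, b, hb, h⟩
    exact ⟨-a, b, hb, by push_cast; rw [← h]; ring⟩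

theorem one_add_two_mul_ne_zero {r : ℝ} (hr : r ∈ oddDenominators) : 1 + 2 * r ≠ 0 := by
  obtain ⟨a, b, hb, h⟩ := hr
  intro h0
  have h1 : (b : ℝ) + 2 * a = 0 := by rw [← h]; linear_combination (b : ℝ) * h0
  have h2 : b + 2 * a = 0 := by exact_mod_cast h1
  obtain ⟨c, rfl⟩ := hb
  lia

theorem two_pow_div_mem {N e : ℕ} (hN : N ≠ 0) (h : ∀ a, 2 ^ a ∣ N → a ≤ e) :
    (2 ^ e / N : ℝ) ∈ oddDenominators := by
  obtain ⟨a, o, ho, rfl⟩ := Nat.exists_eq_two_pow_mul_odd hN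
  have ha : a ≤ e := h a (Dvd.intro _ rfl)
  refine ⟨2 ^ (e - a), o, by exact_mod_cast ho, ?_⟩
  have ho' : (o : ℝ) ≠ 0 := by
    have := ho.pos
    positivity
  push_cast
  rw [← Nat.sub_add_cancel ha, pow_add]
  simp
  field_simp

theorem two_pow_div_add_three_mem (j : ℕ) : (2 ^ (j + 1) / (j + 3) : ℝ) ∈ oddDenominators := by
  have := two_pow_div_mem (N := j + 3) (e := j + 1) (by lia) fun a ha => by
    have h1 := Nat.le_of_dvd (by lia) ha
    have h2 : j + 1 < 2 ^ (j + 1) := Nat.lt_two_pow_self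
    have h3 : 2 ^ a < 2 ^ (j + 2) := by rw [pow_succ]; lia
    have := (Nat.pow_lt_pow_iff_right (by lia : 1 < 2)).mp h3
    lia
  exact_mod_cast this

/-- Of two consecutive integers only one is even, so a power of 2 dividing the product divides one
factor and is at most `j + 3`. -/
theorem two_pow_div_mul_mem (j : ℕ) :
    (2 ^ (j + 1) / ((j + 2) * (j + 3)) : ℝ) ∈ oddDenominators := by
  have := two_pow_div_mem (N := (j + 2) * (j + 3)) (e := j + 1) (by positivity) fun a ha => by
    have h1 : 2 ^ a ≤ j + 3 := by
      rcases Nat.even_or_odd (j + 2) with he | ho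
      · have : Nat.Coprime (2 ^ a) (j + 3) := (Nat.coprime_two_left.mpr he.add_one).pow_left a
        exact (Nat.le_of_dvd (by lia) (this.dvd_of_dvd_mul_right ha)).trans (by lia)
      · have : Nat.Coprime (2 ^ a) (j + 2) := (Nat.coprime_two_left.mpr ho).pow_left a
        exact Nat.le_of_dvd (by lia) (this.dvd_of_dvd_mul_left ha)
    have h2 : j + 1 < 2 ^ (j + 1) := Nat.lt_two_pow_self
    have h3 : 2 ^ a < 2 ^ (j + 2) := by rw [pow_succ]; lia
    have := (Nat.pow_lt_pow_iff_right (by lia : 1 < 2)).mp h3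
    lia
  exact_mod_cast this

/-- Induction on `ratioCoeff_succ` multiplied by `2^k k!`. With `i = p + 1`, the denominator
`2(p+3)` is absorbed by `2^(p+2)`, and the remaining power of 2 is the one in the induction
hypothesis. -/
theorem ratioCoeff_integrality (k : ℕ) :
    2 ^ k * (k + 1).factorial * ratioCoeff (k + 1) ∈ oddDenominators := by
  induction k using Nat.strong_induction_on with
  | _ k ih =>
  have h : 2 ^ k * (k + 1).factorial * ratioCoeff (k + 1) =
      ∑ i ∈ Finset.range (k + 1), 2 ^ k * k.factorial *
        ((-1) ^ (i + 1) * (i / (2 * (i + 2))) * ratioCoeff (k - i)) := by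
    rw [← Finset.mul_sum, ← ratioCoeff_succ, Nat.factorial_succ]
    push_cast
    ring
  rw [h]
  refine sum_mem fun i hi => ?_
  have hik : i ≤ k := Nat.lt_succ_iff.mp (Finset.mem_range.mp hi)
  rw [show (2 ^ k * k.factorial * ((-1) ^ (i + 1) * (i / (2 * (i + 2))) * ratioCoeff (k - i)) : ℝ) =
    (-1) ^ (i + 1) * (2 ^ k * k.factorial * ((i / (2 * (i + 2))) * ratioCoeff (k - i))) by ring]
  refine mul_mem (pow_mem (neg_mem (one_mem _)) _) ?_
  rcases Nat.eq_zero_or_pos i with rfl | hi0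
  · simp
  obtain ⟨p, rfl⟩ := Nat.exists_eq_add_of_lt hi0
  -- For `i = k` the factor is `ratioCoeff 0`, outside the pattern of the induction hypothesis, and
  -- one factor 2 is missing. It comes from `k!` when `k ≥ 2`; for `k = 1` the term is `1/3`.
  rcases hik.eq_or_lt with rfl | hlt
  · rw [Nat.sub_self, ratioCoeff_zero]
    rcases Nat.eq_zero_or_pos p with rfl | hp
    · have := two_pow_div_mem (N := 3) (e := 0) (by lia) fun a ha => by
        have := Nat.le_of_dvd (by lia) ha
        have h4 : 2 ^ a < 2 ^ 2 := by lia
        have := (Nat.pow_lt_pow_iff_right (by lia : 1 < 2)).mp h4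
        interval_cases a <;> lia
      convert this using 1
      norm_num
    · obtain ⟨c, hc⟩ : 2 ∣ (0 + p + 1).factorial := Nat.dvd_factorial (by lia) (by lia)
      have h1 := mul_mem (two_pow_div_add_three_mem p) (natCast_mem oddDenominators (c * (p + 1)))
      convert h1 using 1
      rw [hc]
      push_cast
      simp only [zero_add]
      field_simp
      ring
  · obtain ⟨j, hj⟩ := Nat.exists_eq_add_of_lt hlt
    obtain ⟨c, hc⟩ : (j + 1).factorial ∣ k.factorial := Nat.factorial_dvd_factorial (by lia)
    have h1 := mul_mem (mul_mem (two_pow_div_add_three_mem p)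
      (natCast_mem oddDenominators (c * (p + 1)))) (ih j (by lia))
    rw [show k - (0 + p + 1) = j + 1 by lia]
    convert h1 using 1
    rw [hc, hj]
    push_cast
    simp only [zero_add]
    field_simp
    ring

/-! ### The formal Stirling series. -/

/-- The coefficient of `x ^ m` in `(1 + x) ^ (-i)`. -/
noncomputable def shiftCoeff (i m : ℕ) : ℤ :=
  PowerSeries.coeff m ((PowerSeries.mk fun k => (-1) ^ k : PowerSeries ℤ) ^ i)

theorem coeff_one_add_inv_pow (i m : ℕ) :
    PowerSeries.coeff m ((PowerSeries.mk fun k => (-1) ^ k : PowerSeries ℝ) ^ i) =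
      (shiftCoeff i m : ℝ) := by
  have : (PowerSeries.mk fun k => (-1) ^ k : PowerSeries ℝ) =
      PowerSeries.map (Int.castRingHom ℝ) (PowerSeries.mk fun k => (-1) ^ k) := by
    ext k; simp
  rw [this, ← map_pow, PowerSeries.coeff_map]
  rfl

theorem shiftCoeff_zero_right (i : ℕ) : shiftCoeff i 0 = 1 := by
  simp [shiftCoeff]

theorem shiftCoeff_one_right (i : ℕ) : shiftCoeff i 1 = -i := by
  induction i with
  | zero => simp [shiftCoeff, PowerSeries.coeff_one]
  | succ i ih =>
    have h0 := shiftCoeff_zero_right i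
    rw [shiftCoeff] at ih h0 ⊢
    rw [pow_succ, PowerSeries.coeff_mul]
    simp [Finset.Nat.antidiagonal_succ] at h0 ih ⊢
    rw [ih]

theorem shiftCoeff_zero_left {m : ℕ} (hm : m ≠ 0) : shiftCoeff 0 m = 0 := by
  simp [shiftCoeff, PowerSeries.coeff_one, hm]

/-- The coefficients of the asymptotic expansion of `√(2πn) n ^ n e ^ (-n) / n!` in powers
of `1 / n`. -/
noncomputable def stirlingCoeff : ℕ → ℝ
  | 0 => 1
  | k + 1 => (1 / (k + 1 : ℝ)) * ∑ i : Fin (k + 1),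
      stirlingCoeff i * ((shiftCoeff i (k + 2 - i) : ℝ) - ratioCoeff (k + 2 - i))

theorem stirlingCoeff_zero : stirlingCoeff 0 = 1 := by rw [stirlingCoeff]

theorem stirlingCoeff_succ (k : ℕ) :
    (k + 1) * stirlingCoeff (k + 1) = ∑ i ∈ Finset.range (k + 1),
      stirlingCoeff i * ((shiftCoeff i (k + 2 - i) : ℝ) - ratioCoeff (k + 2 - i)) := by
  rw [stirlingCoeff, Finset.sum_range]
  field_simp

theorem stirlingCoeff_one : stirlingCoeff 1 = -(1 / 12) := by
  have := stirlingCoeff_succ 0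
  simp [stirlingCoeff_zero, shiftCoeff_zero_left, ratioCoeff_two] at this
  linarith

/-- Multiply the recurrence by `4^(k+1) k!`. The terms `i < k` become even, while the term `i = k`
is the preceding odd quantity times `4 * shiftCoeff k 2 - 1/3`, again odd because `ratioCoeff 2 =
1/12`. So oddness propagates. -/
theorem exists_stirlingCoeff_eq (k : ℕ) :
    ∃ r ∈ oddDenominators, 4 ^ k * k.factorial * stirlingCoeff k = 1 + 2 * r := by
  induction k using Nat.strong_induction_on with
  | _ k ih =>
  rcases k with _ | k
  · exact ⟨0, zero_mem _, by simp [stirlingCoeff_zero]⟩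
  have h : 4 ^ (k + 1) * (k + 1).factorial * stirlingCoeff (k + 1) =
      ∑ i ∈ Finset.range (k + 1), 4 ^ (k + 1) * k.factorial * (stirlingCoeff i *
        ((shiftCoeff i (k + 2 - i) : ℝ) - ratioCoeff (k + 2 - i))) := by
    rw [← Finset.mul_sum, ← stirlingCoeff_succ, Nat.factorial_succ]
    push_cast
    ring
  rw [h, Finset.sum_range_succ]
  have hterm : ∀ i ∈ Finset.range k, ∃ s ∈ oddDenominators,
      4 ^ (k + 1) * k.factorial * (stirlingCoeff i *
        ((shiftCoeff i (k + 2 - i) : ℝ) - ratioCoeff (k + 2 - i))) = 2 * s := by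
    intro i hi
    obtain ⟨j, rfl⟩ := Nat.exists_eq_add_of_lt (Finset.mem_range.mp hi)
    obtain ⟨r, hr, hri⟩ := ih i (by lia)
    have hβ : 1 + 2 * r ∈ oddDenominators :=
      add_mem (one_mem _) (mul_mem (ofNat_mem oddDenominators 2) hr)
    have hfac : ((i + j + 1).factorial : ℝ) =
        (i + j + 1).choose i * i.factorial * (j + 1).factorial := by
      rw [← Nat.choose_mul_factorial_mul_factorial (show i ≤ i + j + 1 by lia),
        show i + j + 1 - i = j + 1 by lia]
      push_cast
      ring
    -- The witness uses `4^(j+2) (j+1)! = 2 · 2^(j+1)/((j+2)(j+3)) · 2^(j+2) (j+3)!`, whose last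
    -- factor is the one that makes `ratioCoeff (j+3)` 2-integral.
    refine ⟨(1 + 2 * r) * (((i + j + 1).choose i : ℕ) : ℝ) *
      (2 * 4 ^ (j + 1) * (j + 1).factorial * shiftCoeff i (j + 3) -
        2 ^ (j + 1) / ((j + 2) * (j + 3)) *
          (2 ^ (j + 2) * (j + 2 + 1).factorial * ratioCoeff (j + 2 + 1))), ?_, ?_⟩
    · refine mul_mem (mul_mem hβ (natCast_mem _ _)) (sub_mem ?_ ?_)
      · exact mul_mem (mul_mem (mul_mem (ofNat_mem _ 2) (pow_mem (ofNat_mem _ 4) _))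
          (natCast_mem _ _)) (intCast_mem _ _)
      · exact mul_mem (two_pow_div_mul_mem j) (ratioCoeff_integrality (j + 2))
    · rw [← hri, show i + j + 1 + 2 - i = j + 2 + 1 by lia, hfac,
        show j + 2 + 1 = (j + 1 + 1) + 1 by lia, Nat.factorial_succ (j + 1 + 1),
        Nat.factorial_succ (j + 1), show (4 : ℝ) ^ (i + j + 1 + 1) = 4 ^ i * 4 ^ (j + 2) by ring,
        show (2 : ℝ) ^ (j + 2) = 2 * 2 ^ (j + 1) by ring,
        show (4 : ℝ) ^ (j + 2) = 4 * (2 ^ (j + 1) * 2 ^ (j + 1)) by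
          rw [← mul_pow]; norm_num; ring,
        show (4 : ℝ) ^ (j + 1) = (2 ^ (j + 1) * 2 ^ (j + 1)) by rw [← mul_pow]; norm_num]
      push_cast
      field_simp
      ring
  choose! s hs hs' using hterm
  rw [Finset.sum_congr rfl hs', ← Finset.mul_sum]
  have hsum : ∑ i ∈ Finset.range k, s i ∈ oddDenominators := sum_mem hs
  obtain ⟨r, hr, hrk⟩ := ih k (by lia)
  have h3 : (2 / 3 : ℝ) ∈ oddDenominators := by
    simpa using two_pow_div_add_three_mem 0
  have hc : (2 * shiftCoeff k 2 - 2 / 3 : ℝ) ∈ oddDenominators :=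
    sub_mem (mul_mem (ofNat_mem _ 2) (intCast_mem _ _)) h3
  refine ⟨∑ i ∈ Finset.range k, s i + (r + (2 * shiftCoeff k 2 - 2 / 3) +
    2 * r * (2 * shiftCoeff k 2 - 2 / 3)), ?_, ?_⟩
  · exact add_mem hsum (add_mem (add_mem hr hc) (mul_mem (mul_mem (ofNat_mem _ 2) hr) hc))
  · rw [show k + 2 - k = 2 by lia, ratioCoeff_two]
    linear_combination (4 * (shiftCoeff k 2 : ℝ) - 1 / 3) * hrk

theorem stirlingCoeff_ne_zero (k : ℕ) : stirlingCoeff k ≠ 0 := by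
  obtain ⟨r, hr, h⟩ := exists_stirlingCoeff_eq k
  intro h0
  rw [h0, mul_zero] at h
  exact one_add_two_mul_ne_zero hr h.symm

/-- At `x = 1/n` the point `x/(1+x)` is `1/(n+1)`, so the truncated series satisfies the recursion
of `stirlingQuot` up to this error. The order is `J + 1` although only `J` terms are kept: in the
coefficient of `x^m` the term `i = m` always cancels, so the missing coefficient of index `J` does
not enter at order `J`. -/
theorem isBigO_stirlingCoeff_shift (J : ℕ) :
    (fun x : ℝ => ∑ i ∈ Finset.range J, stirlingCoeff i * (x * (1 + x)⁻¹) ^ i -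
      stirlingRatio x * ∑ i ∈ Finset.range J, stirlingCoeff i * x ^ i) =O[𝓝 0]
      fun x => x ^ (J + 1) := by
  have hinv : AnalyticAt ℝ (fun x : ℝ => (1 + x)⁻¹) 0 :=
    (by fun_prop : AnalyticAt ℝ (fun x : ℝ => 1 + x) 0).fun_inv (by simp)
  have hx : AnalyticAt ℝ (fun x : ℝ => x * (1 + x)⁻¹) 0 := analyticAt_id.fun_mul hinv
  have h1 : ∀ i ∈ Finset.range J,
      AnalyticAt ℝ (fun x : ℝ => stirlingCoeff i * (x * (1 + x)⁻¹) ^ i) 0 :=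
    fun i _ => analyticAt_const.fun_mul (hx.fun_pow i)
  have h2 : ∀ i ∈ Finset.range J, AnalyticAt ℝ (fun x : ℝ => stirlingCoeff i * x ^ i) 0 :=
    fun i _ => by fun_prop
  have h2' : AnalyticAt ℝ (fun x : ℝ => ∑ i ∈ Finset.range J, stirlingCoeff i * x ^ i) 0 :=
    Finset.analyticAt_fun_sum _ h2
  have h3 : AnalyticAt ℝ (fun x : ℝ => -stirlingRatio x *
      ∑ i ∈ Finset.range J, stirlingCoeff i * x ^ i) 0 :=
    analyticAt_stirlingRatio.fun_neg.fun_mul h2'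
  simp_rw [sub_eq_add_neg, ← neg_mul]
  refine isBigO_of_coeff_taylorSeries_eq_zero ((Finset.analyticAt_fun_sum _ h1).fun_add h3) ?_
  intro m hm
  have hneg : taylorSeries (fun x => -stirlingRatio x) = -taylorSeries stirlingRatio := by
    have := taylorSeries_mul (f := fun _ => (-1 : ℝ)) (by fun_prop) analyticAt_stirlingRatio
    rw [taylorSeries_const] at this
    simpa using this
  rw [taylorSeries_add (Finset.analyticAt_fun_sum _ h1) h3, taylorSeries_sum _ h1,
    taylorSeries_mul analyticAt_stirlingRatio.fun_neg h2', taylorSeries_sum _ h2, hneg, neg_mul,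
    map_add, map_neg, Finset.mul_sum, map_sum, map_sum, ← sub_eq_add_neg, ← Finset.sum_sub_distrib]
  have hterm : ∀ i ∈ Finset.range J,
      PowerSeries.coeff m (taylorSeries fun x => stirlingCoeff i * (x * (1 + x)⁻¹) ^ i) -
        PowerSeries.coeff m (taylorSeries stirlingRatio *
          taylorSeries fun x => stirlingCoeff i * x ^ i) =
      if i ≤ m then stirlingCoeff i * ((shiftCoeff i (m - i) : ℝ) - ratioCoeff (m - i)) else 0 := by
    intro i _
    rw [taylorSeries_mul (by fun_prop) (hx.fun_pow i), taylorSeries_pow hx,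
      taylorSeries_mul (by fun_prop) hinv, taylorSeries_mul (by fun_prop) (by fun_prop),
      taylorSeries_const, taylorSeries_pow (by fun_prop), taylorSeries_id,
      taylorSeries_one_add_inv, mul_pow, PowerSeries.coeff_C_mul, PowerSeries.coeff_X_pow_mul',
      show taylorSeries stirlingRatio * (PowerSeries.C (stirlingCoeff i) * PowerSeries.X ^ i) =
        PowerSeries.C (stirlingCoeff i) * (PowerSeries.X ^ i * taylorSeries stirlingRatio) by ring,
      PowerSeries.coeff_C_mul, PowerSeries.coeff_X_pow_mul', coeff_one_add_inv_pow, ← mul_sub]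
    split_ifs
    · rfl
    · simp
  rw [Finset.sum_congr rfl hterm, ← Finset.sum_filter]
  -- Orders 0 and 1 vanish since both factors start as `1 + 0·x` where it matters; order `k + 2`
  -- vanishes by the recurrence defining `stirlingCoeff (k + 1)`.
  rcases m with _ | _ | k
  · refine Finset.sum_eq_zero fun i hi => ?_
    obtain rfl : i = 0 := by simpa using (Finset.mem_filter.mp hi).2
    simp [shiftCoeff_zero_right, ratioCoeff_zero]
  · refine Finset.sum_eq_zero fun i hi => ?_
    have : i ≤ 1 := (Finset.mem_filter.mp hi).2
    interval_cases i
    · simp [shiftCoeff_zero_left, ratioCoeff_one]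
    · simp [shiftCoeff_zero_right, ratioCoeff_zero]
  · have hJ : k + 2 ≤ J := by lia
    have hsub : (Finset.range J).filter (· ≤ k + 2) =
        if k + 2 < J then Finset.range (k + 3) else Finset.range (k + 2) := by
      ext i
      split_ifs <;> simp <;> lia
    have hmain : ∑ i ∈ Finset.range (k + 2),
        stirlingCoeff i * ((shiftCoeff i (k + 2 - i) : ℝ) - ratioCoeff (k + 2 - i)) = 0 := by
      rw [Finset.sum_range_succ, ← stirlingCoeff_succ, show k + 2 - (k + 1) = 1 by lia,
        shiftCoeff_one_right, ratioCoeff_one]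
      push_cast
      ring
    rw [show k + 1 + 1 = k + 2 from rfl, hsub]
    split_ifs
    · rw [Finset.sum_range_succ, hmain, Nat.sub_self, shiftCoeff_zero_right, ratioCoeff_zero]
      simp
    · exact hmain

/-! ### The Stirling series as an asymptotic expansion. -/

/-- The ratio of Stirling's approximation `√(2πn) (n / e) ^ n` to `n!`. -/
noncomputable def stirlingQuot (n : ℕ) : ℝ :=
  Real.sqrt (2 * Real.pi * n) * (n ^ n * Real.exp (-n) / n.factorial)

theorem tendsto_stirlingQuot : Filter.Tendsto stirlingQuot Filter.atTop (𝓝 1) := by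
  have h := (Stirling.tendsto_stirlingSeq_sqrt_pi).inv₀ (by positivity)
  have h2 := h.const_mul (Real.sqrt Real.pi)
  rw [mul_inv_cancel₀ (by positivity)] at h2
  refine h2.congr fun n => ?_
  rw [stirlingQuot, Stirling.stirlingSeq, inv_div, div_pow, ← Real.exp_nat_mul, mul_one,
    Real.exp_neg, show 2 * Real.pi * n = Real.pi * (2 * n) by ring,
    Real.sqrt_mul Real.pi_pos.le]
  field_simp

theorem stirlingQuot_succ {n : ℕ} (hn : n ≠ 0) :
    stirlingQuot (n + 1) = stirlingRatio (1 / n) * stirlingQuot n := by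
  have hn0 : (0 : ℝ) < n := by positivity
  have hq : logQuot (1 / n) = n * Real.log (1 + 1 / n) := by
    rw [← mul_logQuot]
    field_simp
  have h1 : 1 + 1 / (n : ℝ) = (n + 1) / n := by field_simp
  have hρ : stirlingRatio (1 / n) =
      ((n + 1) / n : ℝ) ^ n * Real.sqrt ((n + 1) / n) * Real.exp (-1) := by
    rw [stirlingRatio, hq, Real.exp_add, h1, show (1 + 1 / (n : ℝ) * (1 / 2)) *
      (n * Real.log ((n + 1) / n)) = n * Real.log ((n + 1) / n) +
        Real.log ((n + 1) / n) * (1 / 2) by field_simp, Real.exp_add, Real.exp_nat_mul,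
      Real.exp_log (by positivity), ← Real.rpow_def_of_pos (by positivity), Real.sqrt_eq_rpow]
  rw [hρ, stirlingQuot, stirlingQuot, Nat.factorial_succ, div_pow,
    Real.sqrt_div (by positivity), Real.sqrt_mul (by positivity),
    Real.sqrt_mul (x := 2 * Real.pi) (by positivity)]
  push_cast
  rw [show -((n : ℝ) + 1) = -n + -1 by ring, Real.exp_add, pow_succ]
  have : Real.sqrt n ≠ 0 := by positivity
  field_simp

theorem inv_pow_sub_inv_pow_succ {n J : ℕ} (hn : n ≠ 0) (hJ : J ≠ 0) :
    1 / (n : ℝ) ^ (J + 1) ≤ 2 * (1 / (n : ℝ) ^ J - 1 / ((n + 1 : ℕ) : ℝ) ^ J) := by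
  obtain ⟨j, rfl⟩ := Nat.exists_eq_succ_of_ne_zero hJ
  have hn0 : (1 : ℝ) ≤ n := by exact_mod_cast Nat.one_le_iff_ne_zero.mpr hn
  have h1 : 1 / ((n + 1 : ℕ) : ℝ) ^ (j + 1) ≤ 1 / (n : ℝ) ^ j * (1 / ((n : ℝ) + 1)) := by
    push_cast
    rw [pow_succ, one_div_mul_one_div]
    gcongr
    linarith
  have h2 : 1 / (n : ℝ) ^ (j + 1 + 1) ≤
      2 * (1 / (n : ℝ) ^ (j + 1) - 1 / (n : ℝ) ^ j * (1 / ((n : ℝ) + 1))) := by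
    rw [show 2 * (1 / (n : ℝ) ^ (j + 1) - 1 / (n : ℝ) ^ j * (1 / ((n : ℝ) + 1))) =
      2 / ((n : ℝ) ^ (j + 1) * (n + 1)) by field_simp; ring,
      div_le_div_iff₀ (by positivity) (by positivity), pow_succ (n : ℝ) (j + 1)]
    have : 0 < (n : ℝ) ^ (j + 1) := by positivity
    nlinarith
  refine h2.trans ?_
  rw [Nat.succ_eq_add_one]
  linarith

/-- Telescoping: the increments are dominated by differences of `2C/n^J`, so the distance to the
limit is at most the first of these values. -/
theorem abs_sub_le_of_tendsto_of_abs_succ_sub_le {V : ℕ → ℝ} {L C : ℝ} {N J : ℕ} (hN : N ≠ 0)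
    (hJ : J ≠ 0) (hV : Filter.Tendsto V Filter.atTop (𝓝 L))
    (h : ∀ n ≥ N, |V (n + 1) - V n| ≤ C * (1 / (n : ℝ) ^ (J + 1))) :
    ∀ n ≥ N, |V n - L| ≤ 2 * C * (1 / (n : ℝ) ^ J) := by
  have hC : 0 ≤ C := by
    have := (abs_nonneg _).trans (h N le_rfl)
    have h2 : 0 < 1 / (N : ℝ) ^ (J + 1) := by positivity
    by_contra hc
    nlinarith
  have hstep : ∀ n ≥ N, |V (n + 1) - V n| ≤
      2 * C * (1 / (n : ℝ) ^ J) - 2 * C * (1 / ((n + 1 : ℕ) : ℝ) ^ J) := fun n hn => by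
    have := mul_le_mul_of_nonneg_left (inv_pow_sub_inv_pow_succ (n := n) (by lia) hJ) hC
    have := h n hn
    linarith
  intro n hn
  have hsum : ∀ k, |V (n + k) - V n| ≤ 2 * C * (1 / (n : ℝ) ^ J) := by
    have : ∀ k, |V (n + k) - V n| ≤
        2 * C * (1 / (n : ℝ) ^ J) - 2 * C * (1 / ((n + k : ℕ) : ℝ) ^ J) := by
      intro k
      induction k with
      | zero => simp
      | succ k ih =>
        have h1 := hstep (n + k) (by lia)
        have h2 := abs_sub_le (V (n + (k + 1))) (V (n + k)) (V n)
        rw [← add_assoc] at h2 ⊢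
        linarith
    intro k
    have h2 : 0 ≤ 2 * C * (1 / ((n + k : ℕ) : ℝ) ^ J) := by positivity
    linarith [this k]
  have hlim : Filter.Tendsto (fun k => |V (n + k) - V n|) Filter.atTop (𝓝 |L - V n|) := by
    refine ((hV.comp ?_).sub_const _).abs
    simpa [add_comm] using Filter.tendsto_add_atTop_nat n
  rw [abs_sub_comm]
  exact le_of_tendsto' hlim hsum

/-- The asymptotic expansion of `√(2πn) (n / e) ^ n / n!` to all orders. -/
theorem stirlingQuot_expansion (J : ℕ) : ∃ C : ℝ, ∃ N : ℕ, ∀ n ≥ N,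
    |stirlingQuot n - ∑ j ∈ Finset.range J, stirlingCoeff j * (1 / (n : ℝ)) ^ j| ≤
      C * (1 / (n : ℝ)) ^ J := by
  rcases Nat.eq_zero_or_pos J with rfl | hJ
  · obtain ⟨N, hN⟩ := Filter.eventually_atTop.mp
      (tendsto_stirlingQuot.abs.eventually_le_const (show |(1 : ℝ)| < 2 by norm_num))
    exact ⟨2, N, fun n hn => by simpa using hN n hn⟩
  set B : ℝ → ℝ := fun x => ∑ i ∈ Finset.range J, stirlingCoeff i * x ^ i with hB
  have hB0 : B 0 = 1 := by
    obtain ⟨j, rfl⟩ := Nat.exists_eq_succ_of_ne_zero hJ.ne'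
    simp [hB, Finset.sum_range_succ', stirlingCoeff_zero]
  have hinv : Filter.Tendsto (fun n : ℕ => 1 / (n : ℝ)) Filter.atTop (𝓝 0) :=
    tendsto_one_div_atTop_nhds_zero_nat
  have hBlim : Filter.Tendsto (fun n : ℕ => B (1 / n)) Filter.atTop (𝓝 1) := by
    have : Continuous B := by fun_prop
    have h := (this.tendsto 0).comp hinv
    rwa [hB0] at h
  obtain ⟨C, hC⟩ := (isBigO_stirlingCoeff_shift J).bound
  have e1 := hinv.eventually hC
  have e2 := hBlim.eventually_const_le (show (1 / 2 : ℝ) < 1 by norm_num)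
  have e3 := hBlim.eventually_le_const (show (1 : ℝ) < 2 by norm_num)
  have e4 := tendsto_stirlingQuot.abs.eventually_le_const (show |(1 : ℝ)| < 2 by norm_num)
  obtain ⟨N, hN⟩ := Filter.eventually_atTop.mp (((e1.and e2).and (e3.and e4)).and
    (Filter.eventually_ge_atTop 1))
  have hN1 : 1 ≤ max N 1 := le_max_right _ _
  -- Dividing by the truncated series turns the approximate recursion into small increments of a
  -- sequence tending to 1.
  have hV : Filter.Tendsto (fun n : ℕ => stirlingQuot n / B (1 / n)) Filter.atTop (𝓝 1) := by
    have h := tendsto_stirlingQuot.div hBlim one_ne_zero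
    rwa [div_one] at h
  -- The 8 is `2 · 4`: eventually the quotient is at most 2 in absolute value and both denominators
  -- are at least `1/2`.
  have hstep : ∀ n ≥ max N 1, |stirlingQuot (n + 1) / B (1 / (n + 1 : ℕ)) -
      stirlingQuot n / B (1 / n)| ≤ (8 * C) * (1 / (n : ℝ) ^ (J + 1)) := by
    intro n hn
    obtain ⟨⟨⟨h1, h2⟩, -, h4⟩, h5⟩ := hN n ((le_max_left _ _).trans hn)
    obtain ⟨⟨⟨-, h2'⟩, -⟩, -⟩ := hN (n + 1) (((le_max_left _ _).trans hn).trans (Nat.le_succ n))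
    have hn0 : (0 : ℝ) < n := by exact_mod_cast h5
    have hx : 1 / (n : ℝ) * (1 + 1 / (n : ℝ))⁻¹ = 1 / (n + 1 : ℕ) := by
      push_cast
      field_simp
    rw [hx] at h1
    change ‖B (1 / (n + 1 : ℕ)) - stirlingRatio (1 / n) * B (1 / n)‖ ≤ _ at h1
    rw [norm_pow, Real.norm_eq_abs, Real.norm_eq_abs, abs_of_pos (show 0 < 1 / (n : ℝ) by positivity),
      one_div_pow] at h1
    rw [stirlingQuot_succ (by lia), div_sub_div _ _ (by linarith) (by linarith),
      show stirlingRatio (1 / n) * stirlingQuot n * B (1 / n) -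
        B (1 / (n + 1 : ℕ)) * stirlingQuot n =
        -(stirlingQuot n * (B (1 / (n + 1 : ℕ)) - stirlingRatio (1 / n) * B (1 / n))) by ring,
      abs_div, abs_neg, abs_mul,
      abs_of_pos (show 0 < B (1 / (n + 1 : ℕ)) * B (1 / n) by apply mul_pos <;> linarith),
      div_le_iff₀ (by apply mul_pos <;> linarith)]
    have hCn : 0 ≤ C * (1 / (n : ℝ) ^ (J + 1)) := (abs_nonneg _).trans h1
    have hBB : 1 / 4 ≤ B (1 / (n + 1 : ℕ)) * B (1 / n) := by nlinarith
    calc _ ≤ 2 * (C * (1 / (n : ℝ) ^ (J + 1))) := by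
          apply mul_le_mul h4 h1 (abs_nonneg _) (by norm_num)
      _ = 8 * (C * (1 / (n : ℝ) ^ (J + 1))) * (1 / 4) := by ring
      _ ≤ 8 * (C * (1 / (n : ℝ) ^ (J + 1))) * (B (1 / (n + 1 : ℕ)) * B (1 / n)) := by gcongr
      _ = _ := by ring
  have hmain := abs_sub_le_of_tendsto_of_abs_succ_sub_le (by lia) hJ.ne' hV hstep
  refine ⟨2 * (2 * (8 * C)), max N 1, fun n hn => ?_⟩
  obtain ⟨⟨⟨-, h2⟩, h3, -⟩, -⟩ := hN n ((le_max_left _ _).trans hn)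
  have hBpos : 0 < B (1 / n) := by linarith
  have := hmain n hn
  change |stirlingQuot n - B (1 / n)| ≤ _
  rw [show stirlingQuot n - B (1 / n) = B (1 / n) * (stirlingQuot n / B (1 / n) - 1) by
    field_simp, abs_mul, abs_of_pos hBpos, one_div_pow, mul_assoc 2]
  exact mul_le_mul h3 this (abs_nonneg _) (by norm_num)

/-! ### Normalised moments and the polynomials of the expansion. -/

/-- The normalised moments `√(2πn) / (2πi) ∮ s ^ (-n) e ^ (n (s - 1)) (s - 1) ^ m ds`, as
determined by integration by parts. -/
noncomputable def momentQuot (n : ℕ) : ℕ → ℝ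
  | 0 => stirlingQuot n
  | 1 => -stirlingQuot n * (1 / n)
  | m + 2 => -((m + 2) * momentQuot n (m + 1) + (m + 1) * momentQuot n m) * (1 / n)

/-- The coefficients of the asymptotic expansion of `momentQuot n m` in powers of `1 / n`. -/
noncomputable def momentCoeff : ℕ → ℕ → ℝ
  | 0, j => stirlingCoeff j
  | _ + 1, 0 => 0
  | 1, j + 1 => -stirlingCoeff j
  | m + 2, j + 1 => -((m + 2) * momentCoeff (m + 1) j + (m + 1) * momentCoeff m j)

/-- Each gain of a factor `1/n` lowers the moment index by at most two. -/
theorem momentCoeff_eq_zero {m j : ℕ} (h : 2 * j < m) : momentCoeff m j = 0 := by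
  induction j generalizing m with
  | zero =>
    obtain ⟨m, rfl⟩ := Nat.exists_eq_succ_of_ne_zero (show m ≠ 0 by lia)
    rw [Nat.succ_eq_add_one, momentCoeff]
  | succ j ih =>
    obtain ⟨m, rfl⟩ := Nat.exists_eq_add_of_le (show 2 ≤ m by lia)
    rw [add_comm 2 m, momentCoeff, ih (by lia), ih (by lia)]
    simp

theorem isBigO_one_div_natCast_one :
    (fun n : ℕ => 1 / (n : ℝ)) =O[Filter.atTop] fun _ => (1 : ℝ) :=
  tendsto_one_div_atTop_nhds_zero_nat.isBigO_one ℝ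

theorem isBigO_mul_one_div_expansion {f : ℕ → ℝ} {a : ℕ → ℝ}
    (hf : ∀ r : ℕ, (fun n => f n - ∑ j ∈ Finset.range r, a j * (1 / (n : ℝ)) ^ j)
      =O[Filter.atTop] fun n => (1 / (n : ℝ)) ^ r)
    {b : ℕ → ℝ} (hb0 : b 0 = 0) (hb : ∀ j, b (j + 1) = a j) (r : ℕ) :
    (fun n => f n * (1 / (n : ℝ)) - ∑ j ∈ Finset.range r, b j * (1 / (n : ℝ)) ^ j)
      =O[Filter.atTop] fun n => (1 / (n : ℝ)) ^ r := by
  cases r with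
  | zero => simpa using (hf 0).mul isBigO_one_div_natCast_one
  | succ r =>
    refine ((hf r).mul (Asymptotics.isBigO_refl (fun n : ℕ => 1 / (n : ℝ)) _)).congr
      (fun n => ?_) fun n => (pow_succ _ _).symm
    rw [Finset.sum_range_succ', hb0, sub_mul, Finset.sum_mul]
    simp_rw [hb, pow_succ, mul_assoc]
    simp

theorem momentQuot_expansion (m r : ℕ) :
    (fun n => momentQuot n m - ∑ j ∈ Finset.range r, momentCoeff m j * (1 / (n : ℝ)) ^ j)
      =O[Filter.atTop] fun n => (1 / (n : ℝ)) ^ r := by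
  have h0 : ∀ r : ℕ, (fun n => stirlingQuot n -
      ∑ j ∈ Finset.range r, stirlingCoeff j * (1 / (n : ℝ)) ^ j)
      =O[Filter.atTop] fun n => (1 / (n : ℝ)) ^ r := fun r => by
    obtain ⟨C, N, h⟩ := stirlingQuot_expansion r
    refine Asymptotics.IsBigO.of_bound C ((Filter.eventually_ge_atTop N).mono fun n hn => ?_)
    rw [Real.norm_eq_abs, Real.norm_of_nonneg (by positivity)]
    exact h n hn
  induction m using Nat.strong_induction_on generalizing r with
  | _ m ih =>
  match m with
  | 0 => simpa only [momentQuot, momentCoeff] using h0 r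
  | 1 =>
    simp_rw [momentQuot]
    refine isBigO_mul_one_div_expansion (a := fun j => -stirlingCoeff j) (fun r => ?_)
      (by rw [momentCoeff]) (fun j => by rw [momentCoeff]) r
    refine (h0 r).neg_left.congr_left fun n => ?_
    simp
    ring
  | m + 2 =>
    simp_rw [momentQuot]
    refine isBigO_mul_one_div_expansion
      (a := fun j => -((m + 2) * momentCoeff (m + 1) j + (m + 1) * momentCoeff m j)) (fun r => ?_)
      (by rw [momentCoeff]) (fun j => by rw [momentCoeff]) r
    refine (((ih (m + 1) (by lia) r).const_mul_left (m + 2)).add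
      ((ih m (by lia) r).const_mul_left (m + 1))).neg_left.congr_left fun n => ?_
    have e : ∑ j ∈ Finset.range r, -((m + 2) * momentCoeff (m + 1) j + (m + 1) * momentCoeff m j) *
        (1 / (n : ℝ)) ^ j = -((m + 2) * ∑ j ∈ Finset.range r, momentCoeff (m + 1) j *
          (1 / (n : ℝ)) ^ j + (m + 1) * ∑ j ∈ Finset.range r, momentCoeff m j *
          (1 / (n : ℝ)) ^ j) := by
      rw [Finset.mul_sum, Finset.mul_sum, ← Finset.sum_add_distrib, ← Finset.sum_neg_distrib]
      exact Finset.sum_congr rfl fun j _ => by ring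
    rw [e]
    ring

/-- The polynomials `h_j` of the expansion. -/
noncomputable def expansionPoly (j : ℕ) : Polynomial ℂ :=
  ∑ m ∈ Finset.range (2 * j + 1),
    Polynomial.C ((-1) ^ m * (momentCoeff m j : ℂ)) * (1 - Polynomial.X) ^ (2 * j - m)

theorem natDegree_one_sub_X_pow_le (k : ℕ) :
    ((1 - Polynomial.X : Polynomial ℂ) ^ k).natDegree ≤ k := by
  have h : (1 - Polynomial.X : Polynomial ℂ).natDegree ≤ 1 := by compute_degree
  simpa using Polynomial.natDegree_pow_le_of_le k h

/-- Only `m = 0` reaches degree `2j`; its coefficient is `stirlingCoeff j`, which is nonzero. -/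
theorem natDegree_expansionPoly (j : ℕ) : (expansionPoly j).natDegree = 2 * j := by
  refine Polynomial.natDegree_eq_of_le_of_coeff_ne_zero ?_ ?_
  · refine Polynomial.natDegree_sum_le_of_forall_le _ _ fun m _ => ?_
    exact (Polynomial.natDegree_C_mul_le _ _).trans
      ((natDegree_one_sub_X_pow_le _).trans (Nat.sub_le _ _))
  · rw [expansionPoly, Finset.sum_range_succ', Polynomial.coeff_add, Polynomial.finsetSum_coeff,
      Finset.sum_eq_zero, zero_add]
    · have h : (1 - Polynomial.X : Polynomial ℂ) ^ (2 * j) =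
          (Polynomial.X - Polynomial.C 1) ^ (2 * j) := by
        rw [← neg_sub, Even.neg_pow (by simp), map_one]
      have h2 := (Polynomial.monic_X_sub_C (1 : ℂ)).pow (2 * j)
      have h3 : ((Polynomial.X - Polynomial.C (1 : ℂ)) ^ (2 * j)).natDegree = 2 * j := by
        rw [Polynomial.natDegree_pow, Polynomial.natDegree_X_sub_C, mul_one]
      rw [Nat.sub_zero, h, Polynomial.coeff_C_mul, momentCoeff]
      rw [Polynomial.Monic, Polynomial.leadingCoeff, h3] at h2
      rw [h2]
      simpa using stirlingCoeff_ne_zero j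
    · intro m hm
      have := Finset.mem_range.mp hm
      refine Polynomial.coeff_eq_zero_of_natDegree_lt ?_
      refine ((Polynomial.natDegree_C_mul_le _ _).trans (natDegree_one_sub_X_pow_le _)).trans_lt ?_
      lia

theorem expansionPoly_one : expansionPoly 1 = Polynomial.C (-(1 / 12) : ℂ) *
    (Polynomial.X ^ 2 + Polynomial.C 10 * Polynomial.X + 1) := by
  simp [expansionPoly, Finset.sum_range_succ, momentCoeff, stirlingCoeff_one, stirlingCoeff_zero]
  have h : (Polynomial.C 12 : Polynomial ℂ) * Polynomial.C 12⁻¹ = 1 := by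
    rw [← Polynomial.C_mul]; simp
  have h12 : (Polynomial.C 12 : Polynomial ℂ) = 12 := rfl
  have h10 : (Polynomial.C 10 : Polynomial ℂ) = 10 := rfl
  rw [h12] at h
  rw [h10]
  linear_combination Polynomial.X * h

/-- Interchange of the two sums. For `j < r` all indices `m ≤ 2j` lie below `2r`, and the larger
ones contribute nothing, so each `expansionPoly j` appears complete. -/
theorem sum_momentCoeff_eq {r : ℕ} (hr : 1 ≤ r) (n : ℕ) {z : ℂ} (hz : z ≠ 1) :
    ∑ m ∈ Finset.range (2 * r), (-1) ^ m * ((1 - z) ^ m)⁻¹ *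
        ∑ j ∈ Finset.range r, (momentCoeff m j : ℂ) * (1 / (n : ℂ)) ^ j =
      1 + ∑ j ∈ Finset.Ico 1 r, (expansionPoly j).eval z / ((n : ℂ) ^ j * (z - 1) ^ (2 * j)) := by
  have hu : 1 - z ≠ 0 := sub_ne_zero.mpr (Ne.symm hz)
  have hterm : ∀ j ∈ Finset.range r, ∑ m ∈ Finset.range (2 * r), (-1) ^ m * ((1 - z) ^ m)⁻¹ *
      ((momentCoeff m j : ℂ) * (1 / (n : ℂ)) ^ j) =
      (expansionPoly j).eval z / ((n : ℂ) ^ j * (z - 1) ^ (2 * j)) := by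
    intro j hj
    have hj' := Finset.mem_range.mp hj
    rw [← Finset.sum_subset (s₁ := Finset.range (2 * j + 1))]
    · rw [expansionPoly, Polynomial.eval_finsetSum, Finset.sum_div]
      refine Finset.sum_congr rfl fun m hm => ?_
      have hm' : m ≤ 2 * j := Nat.lt_succ_iff.mp (Finset.mem_range.mp hm)
      have e : (z - 1) ^ (2 * j) = (1 - z) ^ (2 * j - m) * (1 - z) ^ m := by
        rw [← pow_add, Nat.sub_add_cancel hm', ← neg_sub, Even.neg_pow (by simp)]
      rw [e]
      simp only [Polynomial.eval_mul, Polynomial.eval_C, Polynomial.eval_pow, Polynomial.eval_sub,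
        Polynomial.eval_one, Polynomial.eval_X, one_div, inv_pow]
      field_simp
    · intro m hm
      rw [Finset.mem_range] at hm ⊢
      lia
    · intro m _ hm
      rw [Finset.mem_range] at hm
      rw [momentCoeff_eq_zero (by lia)]
      simp
  simp_rw [Finset.mul_sum]
  rw [Finset.sum_comm, Finset.sum_congr rfl hterm, Finset.range_eq_Ico,
    Finset.sum_eq_sum_Ico_succ_bot (by lia)]
  simp [expansionPoly, momentCoeff, stirlingCoeff_zero]

/-! ### Contour integrals and the exact moments. -/

theorem IsSmoothJordanCurve.continuous {γ : ℝ → ℂ} (h : IsSmoothJordanCurve γ) : Continuous γ :=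
  h.contDiff.continuous

theorem IsSmoothJordanCurve.continuous_deriv {γ : ℝ → ℂ} (h : IsSmoothJordanCurve γ) :
    Continuous (deriv γ) :=
  h.contDiff.continuous_deriv le_rfl

theorem IsSmoothJordanCurve.hasDerivAt {γ : ℝ → ℂ} (h : IsSmoothJordanCurve γ) (t : ℝ) :
    HasDerivAt γ (deriv γ t) t :=
  (h.contDiff.differentiable one_ne_zero t).hasDerivAt

theorem contourInt_congr {γ : ℝ → ℂ} {f g : ℂ → ℂ} (h : ∀ t, f (γ t) = g (γ t)) :
    contourInt γ f = contourInt γ g := by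
  simp only [contourInt, h]

theorem contourInt_const_mul (γ : ℝ → ℂ) (c : ℂ) (f : ℂ → ℂ) :
    contourInt γ (fun s => c * f s) = c * contourInt γ f := by
  simp only [contourInt, mul_assoc, intervalIntegral.integral_const_mul]

theorem contourInt_add {γ : ℝ → ℂ} (hγ : IsSmoothJordanCurve γ) {f g : ℂ → ℂ}
    (hf : Continuous fun t => f (γ t)) (hg : Continuous fun t => g (γ t)) :
    contourInt γ (fun s => f s + g s) = contourInt γ f + contourInt γ g := by
  simp only [contourInt, add_mul]
  have := hγ.continuous_deriv
  exact intervalIntegral.integral_add ((hf.mul this).intervalIntegrable _ _)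
    ((hg.mul this).intervalIntegrable _ _)

theorem contourInt_sum {γ : ℝ → ℂ} (hγ : IsSmoothJordanCurve γ) {ι : Type*} (s : Finset ι)
    {f : ι → ℂ → ℂ} (hf : ∀ i ∈ s, Continuous fun t => f i (γ t)) :
    contourInt γ (fun w => ∑ i ∈ s, f i w) = ∑ i ∈ s, contourInt γ (f i) := by
  simp only [contourInt, Finset.sum_mul]
  exact intervalIntegral.integral_finsetSum fun i hi =>
    ((hf i hi).mul hγ.continuous_deriv).intervalIntegrable _ _

theorem contourInt_eq_zero_of_hasDerivAt {γ : ℝ → ℂ} (hγ : IsSmoothJordanCurve γ) {F f : ℂ → ℂ}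
    (hF : ∀ t, HasDerivAt F (f (γ t)) (γ t)) (hf : Continuous fun t => f (γ t)) :
    contourInt γ f = 0 := by
  rw [contourInt, intervalIntegral.integral_eq_sub_of_hasDerivAt (f := fun t => F (γ t))
    (fun t _ => (hF t).comp t (hγ.hasDerivAt t))
    ((hf.mul hγ.continuous_deriv).intervalIntegrable _ _)]
  have := hγ.periodic 0
  rw [zero_add] at this
  rw [this, sub_self]

/-- `s ^ (-n) e ^ (n (s - 1)) = e ^ (n φ(s))`. -/
noncomputable def expPhase (n : ℕ) (s : ℂ) : ℂ := (s ^ n)⁻¹ * Complex.exp (n * (s - 1))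

theorem hasDerivAt_expPhase (n : ℕ) {s : ℂ} (hs : s ≠ 0) :
    HasDerivAt (expPhase n) (expPhase n s * (n * ((s - 1) / s))) s := by
  have h1 : HasDerivAt (fun s : ℂ => (s ^ n)⁻¹) (-(n * s ^ (n - 1)) / (s ^ n) ^ 2) s :=
    (hasDerivAt_pow n s).fun_inv (pow_ne_zero _ hs)
  have h2 : HasDerivAt (fun s : ℂ => Complex.exp (n * (s - 1))) (Complex.exp (n * (s - 1)) *
      (n * 1)) s := (((hasDerivAt_id s).sub_const 1).const_mul (n : ℂ)).cexp
  refine (h1.fun_mul h2).congr_deriv ?_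
  rw [expPhase]
  rcases n with _ | n
  · simp
  · rw [Nat.add_sub_cancel]
    push_cast
    field_simp
    ring

theorem WindsCounterclockwiseAroundZero.ne_zero {γ : ℝ → ℂ}
    (hw : WindsCounterclockwiseAroundZero γ) (t : ℝ) : γ t ≠ 0 :=
  fun h => hw.1 ⟨t, h⟩

theorem WindsCounterclockwiseAroundZero.contourInt_inv {γ : ℝ → ℂ}
    (hw : WindsCounterclockwiseAroundZero γ) :
    contourInt γ (fun s => s⁻¹) = 2 * (Real.pi : ℂ) * I := by
  have h : (2 * (Real.pi : ℂ) * I) ≠ 0 := Complex.two_pi_I_ne_zero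
  have := hw.2
  rwa [inv_mul_eq_one₀ h, eq_comm] at this

/-- Removing `1/s` leaves an entire function, which has a primitive, so the winding number alone
determines the integral. -/
theorem contourInt_inv_mul_exp {γ : ℝ → ℂ} (hγ : IsSmoothJordanCurve γ)
    (hw : WindsCounterclockwiseAroundZero γ) (c : ℂ) :
    contourInt γ (fun s => s⁻¹ * Complex.exp (c * s)) = 2 * (Real.pi : ℂ) * I := by
  have h0 := hw.ne_zero
  have hc := hγ.continuous
  set q : ℂ → ℂ := dslope (fun s => Complex.exp (c * s)) 0
  have hq : Differentiable ℂ q := by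
    rw [← differentiableOn_univ]
    exact (Complex.differentiableOn_dslope Filter.univ_mem).mpr (by fun_prop)
  have hval : ∀ s, s ≠ 0 → s⁻¹ * Complex.exp (c * s) = s⁻¹ + q s := by
    intro s hs
    have := sub_smul_dslope (fun s => Complex.exp (c * s)) 0 s
    simp only [sub_zero, mul_zero, Complex.exp_zero, smul_eq_mul] at this
    rw [show Complex.exp (c * s) = s * q s + 1 by rw [this]; ring]
    field_simp
    ring
  obtain ⟨F, hF⟩ := hq.isExactOn_univ
  rw [contourInt_congr (g := fun s => s⁻¹ + q s) fun t => hval (γ t) (h0 t),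
    contourInt_add hγ (hc.inv₀ h0) (hq.continuous.comp hc), hw.contourInt_inv,
    contourInt_eq_zero_of_hasDerivAt hγ (fun t => hF (γ t) (mem_univ _))
      (hq.continuous.comp hc), add_zero]

theorem contourInt_inv_pow_mul_exp {γ : ℝ → ℂ} (hγ : IsSmoothJordanCurve γ)
    (hw : WindsCounterclockwiseAroundZero γ) (c : ℂ) (k : ℕ) :
    contourInt γ (fun s => (s ^ (k + 1))⁻¹ * Complex.exp (c * s)) =
      2 * (Real.pi : ℂ) * I * (c ^ k / k.factorial) := by
  have h0 := hw.ne_zero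
  have hc := hγ.continuous
  induction k with
  | zero => simpa using contourInt_inv_mul_exp hγ hw c
  | succ k ih =>
    have hcont : ∀ j, Continuous fun t => (γ t ^ j)⁻¹ * Complex.exp (c * γ t) := fun j =>
      ((hc.pow j).inv₀ fun t => pow_ne_zero _ (h0 t)).mul (by fun_prop)
    have hz := contourInt_eq_zero_of_hasDerivAt hγ
      (F := fun s => (s ^ (k + 1))⁻¹ * Complex.exp (c * s))
      (f := fun s => -(k + 1) * ((s ^ (k + 1 + 1))⁻¹ * Complex.exp (c * s)) +
        c * ((s ^ (k + 1))⁻¹ * Complex.exp (c * s))) (fun t => ?_)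
      ((continuous_const.mul (hcont _)).add (continuous_const.mul (hcont _)))
    · rw [contourInt_add hγ (f := fun s => -(k + 1) * ((s ^ (k + 1 + 1))⁻¹ * Complex.exp (c * s)))
        (g := fun s => c * ((s ^ (k + 1))⁻¹ * Complex.exp (c * s))) (continuous_const.mul (hcont _)) (continuous_const.mul (hcont _)),
        contourInt_const_mul, contourInt_const_mul, ih] at hz
      have hk : (k + 1 : ℂ) ≠ 0 := by exact_mod_cast Nat.succ_ne_zero k
      apply mul_left_cancel₀ hk
      rw [Nat.factorial_succ]
      push_cast
      have hk2 : (k.factorial : ℂ) ≠ 0 := by exact_mod_cast k.factorial_ne_zero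
      rw [show (k + 1 : ℂ) * (2 * (Real.pi : ℂ) * I * (c ^ (k + 1) / ((k + 1) * k.factorial))) =
        c * (2 * (Real.pi : ℂ) * I * (c ^ k / k.factorial)) by field_simp; ring]
      linear_combination -hz
    · have h1 : HasDerivAt (fun s : ℂ => (s ^ (k + 1))⁻¹)
          (-((k + 1 : ℕ) * γ t ^ k) / (γ t ^ (k + 1)) ^ 2) (γ t) :=
        (hasDerivAt_pow (k + 1) (γ t)).fun_inv (pow_ne_zero _ (h0 t))
      have h2 : HasDerivAt (fun s : ℂ => Complex.exp (c * s)) (Complex.exp (c * γ t) * (c * 1))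
          (γ t) := ((hasDerivAt_id (γ t)).const_mul c).cexp
      refine (h1.fun_mul h2).congr_deriv ?_
      have := h0 t
      push_cast
      field_simp
      ring

/-- The moments of the kernel `s ^ (-n) e ^ (n (s - 1))` along `γ`. -/
noncomputable def contourMoment (γ : ℝ → ℂ) (n m : ℕ) : ℂ :=
  contourInt γ (fun s => expPhase n s * (s - 1) ^ m)

theorem continuous_expPhase_comp {γ : ℝ → ℂ} (hγ : IsSmoothJordanCurve γ)
    (hw : WindsCounterclockwiseAroundZero γ) (n : ℕ) : Continuous fun t => expPhase n (γ t) := by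
  have h0 := hw.ne_zero
  have hc := hγ.continuous
  exact ((hc.pow n).inv₀ fun t => pow_ne_zero _ (h0 t)).mul (by fun_prop)

theorem contourMoment_zero {γ : ℝ → ℂ} (hγ : IsSmoothJordanCurve γ)
    (hw : WindsCounterclockwiseAroundZero γ) {n : ℕ} (hn : n ≠ 0) :
    contourMoment γ n 0 = 2 * (Real.pi : ℂ) * I *
      (n ^ n * Real.exp (-n) / n.factorial : ℝ) := by
  obtain ⟨k, rfl⟩ := Nat.exists_eq_succ_of_ne_zero hn
  rw [contourMoment, contourInt_congr (g := fun s => Complex.exp (-(k + 1 : ℕ)) *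
    ((s ^ (k + 1))⁻¹ * Complex.exp ((k + 1 : ℕ) * s))), contourInt_const_mul,
    contourInt_inv_pow_mul_exp hγ hw, Nat.succ_eq_add_one, Nat.factorial_succ, pow_succ]
  · have hk : (k + 1 : ℂ) ≠ 0 := by exact_mod_cast Nat.succ_ne_zero k
    push_cast
    field_simp
  · intro t
    rw [pow_zero, mul_one, expPhase, mul_left_comm, ← Complex.exp_add, Nat.succ_eq_add_one]
    ring_nf

/-- Integrate the exact derivative of `expPhase n s * (s-1)^m * s`; the extra factor `s` cancels the
denominator of `n φ'(s) = n(s-1)/s`. -/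
theorem contourMoment_succ {γ : ℝ → ℂ} (hγ : IsSmoothJordanCurve γ)
    (hw : WindsCounterclockwiseAroundZero γ) (n m : ℕ) :
    n * contourMoment γ n (m + 1) + (m + 1) * contourMoment γ n m +
      m * contourMoment γ n (m - 1) = 0 := by
  have h0 := hw.ne_zero
  have hc := hγ.continuous
  have hcont : ∀ (c : ℂ) j, Continuous fun t => c * (expPhase n (γ t) * (γ t - 1) ^ j) :=
    fun c j => continuous_const.mul ((continuous_expPhase_comp hγ hw n).mul (by fun_prop))
  have hz := contourInt_eq_zero_of_hasDerivAt hγ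
    (F := fun s => expPhase n s * ((s - 1) ^ m * s))
    (f := fun s => n * (expPhase n s * (s - 1) ^ (m + 1)) + (m + 1) * (expPhase n s * (s - 1) ^ m) +
      m * (expPhase n s * (s - 1) ^ (m - 1))) (fun t => ?_)
    (((hcont _ _).add (hcont _ _)).add (hcont _ _))
  · rwa [contourInt_add hγ ((hcont _ _).add (hcont _ _)) (hcont _ _),
      contourInt_add hγ (hcont _ _) (hcont _ _), contourInt_const_mul, contourInt_const_mul,
      contourInt_const_mul] at hz
  · have h1 := hasDerivAt_expPhase n (h0 t)
    have h2 : HasDerivAt (fun s : ℂ => (s - 1) ^ m) (m * (γ t - 1) ^ (m - 1) * 1) (γ t) :=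
      ((hasDerivAt_id (γ t)).sub_const 1).pow m
    refine (h1.fun_mul (h2.fun_mul (hasDerivAt_id' (γ t)))).congr_deriv ?_
    have := h0 t
    rcases m with _ | m
    · simp
      field_simp
    · rw [Nat.add_sub_cancel]
      push_cast
      field_simp
      ring

theorem sqrt_mul_contourMoment {γ : ℝ → ℂ} (hγ : IsSmoothJordanCurve γ)
    (hw : WindsCounterclockwiseAroundZero γ) {n : ℕ} (hn : n ≠ 0) (m : ℕ) :
    (Real.sqrt (2 * Real.pi * n) : ℂ) * ((2 * (Real.pi : ℂ) * I)⁻¹ * contourMoment γ n m) =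
      (momentQuot n m : ℂ) := by
  have hpi : (2 * (Real.pi : ℂ) * I) ≠ 0 := Complex.two_pi_I_ne_zero
  have hn' : (n : ℂ) ≠ 0 := by exact_mod_cast hn
  induction m using Nat.strong_induction_on with
  | _ m ih =>
  match m with
  | 0 =>
    rw [contourMoment_zero hγ hw hn, inv_mul_cancel_left₀ hpi, momentQuot, stirlingQuot]
    push_cast
    rfl
  | 1 =>
    have h := contourMoment_succ hγ hw n 0
    have h0 := ih 0 (by lia)
    rw [momentQuot] at h0
    rw [momentQuot]
    push_cast
    rw [← h0]
    rw [show contourMoment γ n 1 = -contourMoment γ n 0 * (1 / n) by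
      field_simp
      simp at h
      linear_combination h]
    ring
  | m + 2 =>
    have h := contourMoment_succ hγ hw n (m + 1)
    rw [momentQuot]
    push_cast
    rw [← ih m (by lia), ← ih (m + 1) (by lia), show contourMoment γ n (m + 2) =
      -((m + 2) * contourMoment γ n (m + 1) + (m + 1) * contourMoment γ n m) * (1 / n) by
      field_simp
      rw [Nat.add_sub_cancel] at h
      push_cast at h
      linear_combination h]
    ring

/-! ### The phase function: its zero, and estimates of its real part. -/

/-- The real part of the phase function. -/
noncomputable def potential (s : ℂ) : ℝ := s.re - 1 - Real.log ‖s‖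

theorem phase_re (s : ℂ) : (phase s).re = potential s := by
  simp [phase, potential, Complex.log_re]

theorem norm_expPhase (n : ℕ) {s : ℂ} (hs : s ≠ 0) :
    ‖expPhase n s‖ = Real.exp (n * potential s) := by
  have h : 0 < ‖s‖ := norm_pos_iff.mpr hs
  rw [expPhase, norm_mul, norm_inv, norm_pow, Complex.norm_exp, potential, mul_sub (n : ℝ), Real.exp_sub,
    Real.exp_nat_mul (Real.log ‖s‖), Real.exp_log h]
  simp
  field_simp

theorem continuousOn_potential : ContinuousOn potential {0}ᶜ := by
  refine ContinuousOn.sub (by fun_prop) (ContinuousOn.log (by fun_prop) ?_)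
  intro s hs
  exact norm_ne_zero_iff.mpr hs

/-- In polar form `Re s - 1 = log|s|` and `|s| sin θ = θ`. If `θ ≠ 0`, the second forces `|s| ≥ 1`,
hence `Re s ≥ 1` and `|θ| < π/2`; then `tan|θ| > |θ|` gives `Re s < 1`. If `θ = 0`, strictness of
`log x ≤ x - 1` away from 1 decides. -/
theorem eq_one_of_phase_eq_zero {s : ℂ} (hs : s ≠ 0) (h : phase s = 0) : s = 1 := by
  have hr : s.re - 1 = Real.log ‖s‖ := by
    have := phase_re s
    rw [h, potential, Complex.zero_re] at this
    linarith
  have hi : s.im = s.arg := by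
    have := congrArg Complex.im h
    simp [phase, Complex.log_im] at this
    linarith
  have hpos : 0 < ‖s‖ := norm_pos_iff.mpr hs
  have hcos : ‖s‖ * Real.cos s.arg = s.re := Complex.norm_mul_cos_arg s
  have hsin : ‖s‖ * Real.sin s.arg = s.im := Complex.norm_mul_sin_arg s
  rw [hi] at hsin
  by_cases h0 : s.arg = 0
  · have him : s.im = 0 := hi.trans h0
    rw [h0, Real.cos_zero, mul_one] at hcos
    have h1 : ‖s‖ = 1 := by
      by_contra hne
      have := Real.log_lt_sub_one_of_pos hpos hne
      linarith
    exact Complex.ext (by rw [← hcos, h1, Complex.one_re]) (by rw [him, Complex.one_im])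
  · exfalso
    have habs : |s.arg| ≤ ‖s‖ * |s.arg| := by
      have h2 : ‖s‖ * |Real.sin s.arg| = |s.arg| := by
        have := congrArg abs hsin
        rwa [abs_mul, abs_of_pos hpos] at this
      have h3 : |Real.sin s.arg| ≤ |s.arg| := Real.abs_sin_le_abs
      nlinarith
    have hnorm : 1 ≤ ‖s‖ := by
      have : 0 < |s.arg| := abs_pos.mpr h0
      by_contra hlt
      nlinarith
    have hre : 1 ≤ s.re := by
      have := Real.log_nonneg hnorm
      linarith
    have hcpos : 0 < Real.cos s.arg := by
      by_contra hc
      nlinarith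
    have harg : |s.arg| < Real.pi / 2 := by
      rw [Complex.abs_arg_lt_pi_div_two_iff]
      left; linarith
    have h1 : |s.arg| < Real.tan |s.arg| := Real.lt_tan (abs_pos.mpr h0) harg
    have hcabs : Real.cos |s.arg| = Real.cos s.arg := Real.cos_abs _
    rw [Real.tan_eq_sin_div_cos, hcabs, lt_div_iff₀ hcpos] at h1
    have hsabs : ‖s‖ * Real.sin |s.arg| = |s.arg| := by
      have hs0 : 0 ≤ Real.sin |s.arg| :=
        Real.sin_nonneg_of_nonneg_of_le_pi (abs_nonneg _) (by linarith [Real.pi_pos])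
      rcases abs_choice s.arg with e | e <;> rw [e] at *
      · exact hsin
      · rw [Real.sin_neg]; linarith
    have h4 : |s.arg| * s.re < |s.arg| := by
      rw [← hcos, ← hsabs]
      have := mul_lt_mul_of_pos_left h1 hpos
      nlinarith [hsabs]
    have := abs_pos.mpr h0
    nlinarith

theorem norm_phase_one_add_sub_le {v : ℂ} (hv : ‖v‖ ≤ 1 / 4) :
    ‖phase (1 + v) - v ^ 2 / 2‖ ≤ ‖v‖ ^ 3 := by
  have h := Complex.norm_log_sub_logTaylor_le 2 (show ‖v‖ < 1 by linarith)
  have e : phase (1 + v) - v ^ 2 / 2 = -(Complex.log (1 + v) - Complex.logTaylor (2 + 1) v) := by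
    simp [phase, Complex.logTaylor_succ, Complex.logTaylor_zero]
    ring
  rw [e, norm_neg]
  refine h.trans ?_
  have h1 : (1 - ‖v‖)⁻¹ ≤ 2 := by
    rw [inv_le_comm₀ (by linarith) (by norm_num)]
    linarith
  have h2 : 0 ≤ ‖v‖ ^ 3 := by positivity
  norm_num
  nlinarith

/-- On the path `φ` is real and nonpositive, so `-Re φ = |φ|`, which is at least `|s-1|²/2 -
|s-1|³`. -/
theorem potential_le_of_mem_steepestDescentPath {s : ℂ} (hs : s ∈ steepestDescentPath)
    (h : ‖s - 1‖ ≤ 1 / 4) : potential s ≤ -(1 / 4) * ‖s - 1‖ ^ 2 := by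
  obtain ⟨-, him, hre⟩ := hs
  have h1 := norm_phase_one_add_sub_le h
  rw [add_sub_cancel] at h1
  have h2 : ‖phase s‖ = -potential s := by
    rw [← phase_re, ← abs_of_nonpos hre, ← Complex.abs_re_eq_norm.mpr him]
  have h3 : ‖(s - 1) ^ 2 / 2‖ ≤ ‖phase s‖ + ‖s - 1‖ ^ 3 := by
    calc ‖(s - 1) ^ 2 / 2‖ = ‖phase s - (phase s - (s - 1) ^ 2 / 2)‖ := by ring_nf
      _ ≤ _ := (norm_sub_le _ _).trans (by gcongr)
  rw [norm_div, norm_pow, h2] at h3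
  norm_num at h3
  nlinarith [norm_nonneg (s - 1), sq_nonneg ‖s - 1‖]

/-- First-order Taylor bound with `φ'(s) = (s-1)/s`. Only `log(1 + (ξ-s)/s)` occurs, so the branch
cut plays no role. -/
theorem potential_le_add {s ξ : ℂ} (hs : s ≠ 0) (h : ‖ξ - s‖ ≤ ‖s‖ / 2) :
    potential ξ ≤ potential s + ‖ξ - s‖ * ‖s - 1‖ / ‖s‖ + ‖ξ - s‖ ^ 2 / ‖s‖ ^ 2 := by
  have hpos : 0 < ‖s‖ := norm_pos_iff.mpr hs
  set η := (ξ - s) / s with hη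
  have hηn : ‖η‖ = ‖ξ - s‖ / ‖s‖ := norm_div _ _
  have hη2 : ‖η‖ ≤ 1 / 2 := by
    rw [hηn, div_le_iff₀ hpos]
    linarith
  have hξ : ξ = s * (1 + η) := by rw [hη]; field_simp; ring
  have h1η : 1 + η ≠ 0 := by
    intro h0
    have : η = -1 := by linear_combination h0
    rw [this, norm_neg, norm_one] at hη2
    norm_num at hη2
  have hlog : Real.log ‖ξ‖ = Real.log ‖s‖ + (Complex.log (1 + η)).re := by
    rw [hξ, norm_mul, Real.log_mul hpos.ne' (norm_ne_zero_iff.mpr h1η), Complex.log_re]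
  have h2 := Complex.norm_log_one_add_sub_self_le (show ‖η‖ < 1 by linarith)
  have h3 : ‖Complex.log (1 + η) - η‖ ≤ ‖η‖ ^ 2 := by
    refine h2.trans ?_
    have h4 : (1 - ‖η‖)⁻¹ ≤ 2 := by
      rw [inv_le_comm₀ (by linarith) (by norm_num)]
      linarith
    nlinarith [sq_nonneg ‖η‖]
  have h5 : ((ξ - s) - η).re ≤ ‖ξ - s‖ * ‖s - 1‖ / ‖s‖ := by
    rw [← norm_mul, ← norm_div, show (ξ - s) - η = (ξ - s) * (s - 1) / s by rw [hη]; field_simp]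
    exact Complex.re_le_norm _
  have h6 : -(Complex.log (1 + η) - η).re ≤ ‖η‖ ^ 2 :=
    ((neg_le_abs _).trans (Complex.abs_re_le_norm _)).trans h3
  rw [hηn, div_pow] at h6
  simp only [Complex.sub_re] at h5 h6
  rw [potential, potential, hlog]
  linarith

/-! ### Uniform geometry of smooth Jordan curves. -/

theorem Function.Periodic.apply_fract {α : Type*} {f : ℝ → α} (h : Function.Periodic f 1) (t : ℝ) :
    f (Int.fract t) = f t := by
  have := h.sub_int_mul_eq ⌊t⌋ (x := t)
  rwa [mul_one] at this

namespace IsSmoothJordanCurve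

variable {γ : ℝ → ℂ}

theorem periodic_deriv (h : IsSmoothJordanCurve γ) : Function.Periodic (deriv γ) 1 := by
  intro t
  rw [← deriv_comp_add_const]
  exact congrArg (fun f => deriv f t) (funext h.periodic)

theorem eq_add_int (h : IsSmoothJordanCurve γ) {t u : ℝ} (htu : γ t = γ u) :
    ∃ k : ℤ, t - u = k := by
  have h1 : Int.fract t = Int.fract u := by
    refine h.injOn ⟨Int.fract_nonneg _, Int.fract_lt_one _⟩ ⟨Int.fract_nonneg _, Int.fract_lt_one _⟩ ?_
    rw [h.periodic.apply_fract, h.periodic.apply_fract, htu]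
  exact Int.fract_eq_fract.mp h1

theorem exists_le_norm_deriv (h : IsSmoothJordanCurve γ) : ∃ m, 0 < m ∧ ∀ t, m ≤ ‖deriv γ t‖ := by
  obtain ⟨m, hm, hm'⟩ := (isCompact_Icc (a := (0 : ℝ)) (b := 1)).exists_forall_le'
    h.continuous_deriv.norm.continuousOn (a := 0) fun t _ => norm_pos_iff.mpr (h.deriv_ne_zero t)
  refine ⟨m, hm, fun t => ?_⟩
  rw [← h.periodic_deriv.apply_fract t]
  exact hm' _ ⟨Int.fract_nonneg _, (Int.fract_lt_one _).le⟩

theorem exists_norm_deriv_le (h : IsSmoothJordanCurve γ) : ∃ M, 0 < M ∧ ∀ t, ‖deriv γ t‖ ≤ M := by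
  obtain ⟨M, hM⟩ := (h.periodic_deriv.isBounded_of_continuous one_ne_zero
    h.continuous_deriv).exists_norm_le
  have h0 : ‖deriv γ 0‖ ≤ M := hM _ (mem_range_self 0)
  exact ⟨M, (norm_pos_iff.mpr (h.deriv_ne_zero 0)).trans_le h0, fun t => hM _ (mem_range_self t)⟩

theorem exists_modulus (h : IsSmoothJordanCurve γ) {ε : ℝ} (hε : 0 < ε) :
    ∃ l, 0 < l ∧ l ≤ 1 / 2 ∧ ∀ t u, |t - u| ≤ l → ‖deriv γ t - deriv γ u‖ ≤ ε := by
  have huc := (isCompact_Icc (a := (-1 : ℝ)) (b := 2)).uniformContinuousOn_of_continuous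
    h.continuous_deriv.continuousOn
  obtain ⟨δ, hδ, hd⟩ := Metric.uniformContinuousOn_iff.mp huc ε hε
  refine ⟨min (δ / 2) (1 / 2), by positivity, min_le_right _ _, fun t u htu => ?_⟩
  have h1 := htu.trans (min_le_left _ _)
  have h2 := abs_le.mp (htu.trans (min_le_right _ _))
  have e1 : deriv γ (t - ⌊u⌋) = deriv γ t := by
    have := h.periodic_deriv.sub_int_mul_eq ⌊u⌋ (x := t)
    rwa [mul_one] at this
  have e2 : deriv γ (u - ⌊u⌋) = deriv γ u := h.periodic_deriv.apply_fract u
  have h3 := Int.floor_le u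
  have h4 := (Int.lt_floor_add_one u).le
  rw [← e1, ← e2, ← dist_eq_norm]
  refine (hd _ ⟨by linarith, by linarith⟩ _ ⟨by linarith, by linarith⟩ ?_).le
  rw [Real.dist_eq, show t - ⌊u⌋ - (u - ⌊u⌋) = t - u by ring]
  linarith

theorem norm_sub_sub_le (h : IsSmoothJordanCurve γ) {ε t u : ℝ}
    (hε : ∀ v, |v - u| ≤ |t - u| → ‖deriv γ v - deriv γ u‖ ≤ ε) :
    ‖γ t - γ u - (t - u) * deriv γ u‖ ≤ ε * |t - u| := by
  have h1 : ∀ x ∈ uIcc u t, HasDerivWithinAt (fun x : ℝ => γ x - x * deriv γ u)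
      (deriv γ x - 1 * deriv γ u) (uIcc u t) x := fun x _ =>
    ((h.hasDerivAt x).sub (((hasDerivAt_id x).ofReal_comp).mul_const _)).hasDerivWithinAt
  have h2 := Convex.norm_image_sub_le_of_norm_hasDerivWithin_le (C := ε) h1 (fun x hx => by
    rw [one_mul]
    exact hε x (abs_sub_left_of_mem_uIcc hx)) (convex_uIcc u t) left_mem_uIcc right_mem_uIcc
  rw [Real.norm_eq_abs] at h2
  rw [show γ t - γ u - (t - u) * deriv γ u = γ t - t * deriv γ u - (γ u - u * deriv γ u) by ring]
  exact h2

/-- For close parameters the derivative is nearly constant and bounded below; for the others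
injectivity and compactness apply, after an integer translation. Half a period is the largest gap
needed modulo 1. -/
theorem exists_chord_arc (h : IsSmoothJordanCurve γ) :
    ∃ c, 0 < c ∧ ∀ t u, |t - u| ≤ 1 / 2 → c * |t - u| ≤ ‖γ t - γ u‖ := by
  obtain ⟨m, hm, hm'⟩ := h.exists_le_norm_deriv
  obtain ⟨l, hl, -, hl'⟩ := h.exists_modulus (half_pos hm)
  set K : Set (ℝ × ℝ) := (Icc (-1) 2 ×ˢ Icc 0 1) ∩ {p | l ≤ |p.1 - p.2| ∧ |p.1 - p.2| ≤ 1 / 2}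
  have hK : IsCompact K := by
    refine (isCompact_Icc.prod isCompact_Icc).inter_right ?_
    have c1 : IsClosed {p : ℝ × ℝ | l ≤ |p.1 - p.2|} := isClosed_le (by fun_prop) (by fun_prop)
    have c2 : IsClosed {p : ℝ × ℝ | |p.1 - p.2| ≤ 1 / 2} := isClosed_le (by fun_prop) (by fun_prop)
    exact c1.inter c2
  have hc := h.continuous
  obtain ⟨c, hc0, hcK⟩ := hK.exists_forall_le' (f := fun p => ‖γ p.1 - γ p.2‖) (a := 0)
    (by fun_prop) fun p hp => by
      rw [norm_pos_iff, sub_ne_zero]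
      intro he
      obtain ⟨k, hk⟩ := h.eq_add_int he
      obtain ⟨-, h1, h2⟩ := hp
      rw [hk] at h1 h2
      have h3 : |k| < 1 := by
        have : ((|k| : ℤ) : ℝ) < 1 := by push_cast; linarith
        exact_mod_cast this
      rw [Int.abs_lt_one_iff] at h3
      rw [h3] at h1
      simp at h1
      linarith
  refine ⟨min (m / 2) (2 * c), by positivity, fun t u htu => ?_⟩
  rcases le_total |t - u| l with hle | hge
  · have h1 := h.norm_sub_sub_le (ε := m / 2) (t := t) (u := u) fun v hv => hl' v u (hv.trans hle)
    have h2 : ‖((t - u : ℝ) : ℂ) * deriv γ u‖ ≤ ‖γ t - γ u‖ +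
        ‖γ t - γ u - (t - u) * deriv γ u‖ := by
      rw [show ((t - u : ℝ) : ℂ) * deriv γ u = (γ t - γ u) -
        (γ t - γ u - (t - u) * deriv γ u) by push_cast; ring]
      exact norm_sub_le _ _
    rw [norm_mul, Complex.norm_real, Real.norm_eq_abs] at h2
    have h3 := mul_le_mul_of_nonneg_left (hm' u) (abs_nonneg (t - u))
    have h4 := mul_le_mul_of_nonneg_right (min_le_left (m / 2) (2 * c)) (abs_nonneg (t - u))
    linarith
  · have e1 : γ (t - ⌊u⌋) = γ t := by
      have := h.periodic.sub_int_mul_eq ⌊u⌋ (x := t)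
      rwa [mul_one] at this
    have e2 : γ (u - ⌊u⌋) = γ u := h.periodic.apply_fract u
    have h3 := Int.floor_le u
    have h4 := (Int.lt_floor_add_one u).le
    have h5 := abs_le.mp htu
    have h6 := hcK (t - ⌊u⌋, u - ⌊u⌋) ⟨⟨⟨by linarith, by linarith⟩, by linarith, by linarith⟩,
      show l ≤ |t - ⌊u⌋ - (u - ⌊u⌋)| ∧ |t - ⌊u⌋ - (u - ⌊u⌋)| ≤ 1 / 2 by
        rw [sub_sub_sub_cancel_right]
        exact ⟨hge, htu⟩⟩
    simp only [e1, e2] at h6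
    have h7 := mul_le_mul_of_nonneg_right (min_le_right (m / 2) (2 * c)) (abs_nonneg (t - u))
    nlinarith

end IsSmoothJordanCurve

/-! ### Decay of the kernel along an admissible contour. -/

namespace IsAdmissible

variable {γ : ℝ → ℂ}

theorem one_mem_range (h : IsAdmissible γ) : ∃ t, γ t = 1 := by
  obtain ⟨U, -, h1, hU, -⟩ := h.descent
  have : (1 : ℂ) ∈ range γ ∩ U := by
    rw [hU]
    exact ⟨⟨one_ne_zero, by simp [phase], by simp [phase]⟩, h1⟩
  exact this.1

theorem exists_le_norm (h : IsAdmissible γ) : ∃ a, 0 < a ∧ ∀ t, a ≤ ‖γ t‖ := by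
  obtain ⟨m, hm, hm'⟩ := (isCompact_Icc (a := (0 : ℝ)) (b := 1)).exists_forall_le'
    h.jordan.continuous.norm.continuousOn (a := 0) fun t _ => norm_pos_iff.mpr (h.winding.ne_zero t)
  refine ⟨m, hm, fun t => ?_⟩
  rw [← h.jordan.periodic.apply_fract t]
  exact hm' _ ⟨Int.fract_nonneg _, (Int.fract_lt_one _).le⟩

theorem continuous_potential (h : IsAdmissible γ) : Continuous fun t => potential (γ t) :=
  continuousOn_potential.comp_continuous h.jordan.continuous h.winding.ne_zero

/-- Inside `U` the imaginary part of `φ` vanishes too, leaving only the point 1; outside `U` the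
contour keeps its distance from the level curve. -/
theorem potential_ne_zero (h : IsAdmissible γ) {t : ℝ} (ht : γ t ≠ 1) : potential (γ t) ≠ 0 := by
  obtain ⟨U, -, -, hU, δ, hδ, hd⟩ := h.descent
  have h0 := h.winding.ne_zero t
  intro hp
  by_cases hmem : γ t ∈ U
  · have : γ t ∈ steepestDescentPath ∩ U := hU ▸ ⟨mem_range_self t, hmem⟩
    refine ht (eq_one_of_phase_eq_zero h0 (Complex.ext ?_ this.1.2.1))
    rw [phase_re, hp, Complex.zero_re]
  · have := hd (γ t) ⟨mem_range_self t, hmem⟩ (γ t) ⟨h0, by rw [phase_re, hp]⟩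
    rw [dist_self] at this
    linarith

/-- On one open period starting at the parameter of 1 the potential has no zero, hence constant
sign, and it is negative just after the start, where the contour is the descent path. -/
theorem potential_neg (h : IsAdmissible γ) {t : ℝ} (ht : γ t ≠ 1) : potential (γ t) < 0 := by
  obtain ⟨t₀, ht₀⟩ := h.one_mem_range
  have hne : ∀ u ∈ Ioo t₀ (t₀ + 1), potential (γ u) ≠ 0 := by
    intro u hu
    refine h.potential_ne_zero fun h1 => ?_
    obtain ⟨k, hk⟩ := h.jordan.eq_add_int (h1.trans ht₀.symm)
    have h2 : (0 : ℝ) < k := by rw [← hk]; linarith [hu.1]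
    have h3 : (k : ℝ) < 1 := by rw [← hk]; linarith [hu.2]
    have h4 : 0 < k := by exact_mod_cast h2
    have h5 : k < 1 := by exact_mod_cast h3
    lia
  obtain ⟨u, hu, hu'⟩ : ∃ u ∈ Ioo t₀ (t₀ + 1), potential (γ u) < 0 := by
    obtain ⟨U, hUo, h1, hU, -⟩ := h.descent
    have e1 : ∀ᶠ u in 𝓝[>] t₀, γ u ∈ U := by
      refine nhdsWithin_le_nhds (h.jordan.continuous.continuousAt.eventually_mem ?_)
      rw [ht₀]
      exact hUo.mem_nhds h1
    have e2 : ∀ᶠ u in 𝓝[>] t₀, u ∈ Ioo t₀ (t₀ + 1) := Ioo_mem_nhdsGT (by linarith)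
    obtain ⟨u, hu1, hu2⟩ := (e1.and e2).exists
    have : γ u ∈ steepestDescentPath ∩ U := hU ▸ ⟨mem_range_self u, hu1⟩
    have hre := this.1.2.2
    rw [phase_re] at hre
    exact ⟨u, hu2, lt_of_le_of_ne hre (hne u hu2)⟩
  have hall : ∀ v ∈ Ioo t₀ (t₀ + 1), potential (γ v) < 0 := by
    intro v hv
    by_contra hc
    obtain ⟨w, hw, hw'⟩ := isPreconnected_Ioo.intermediate_value hu hv
      h.continuous_potential.continuousOn ⟨hu'.le, not_lt.mp hc⟩
    exact hne w hw hw'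
  obtain ⟨v, hv, hv'⟩ := h.jordan.periodic.exists_mem_Ico one_pos t t₀
  rw [hv'] at ht ⊢
  refine hall v ⟨lt_of_le_of_ne hv.1 ?_, hv.2⟩
  rintro rfl
  exact ht ht₀

/-- Quadratic decay on the descent path near 1; compactness and strict negativity elsewhere. -/
theorem exists_potential_le (h : IsAdmissible γ) :
    ∃ c, 0 < c ∧ ∀ t, potential (γ t) ≤ -c * ‖γ t - 1‖ ^ 2 := by
  obtain ⟨U, hUo, h1, hU, -⟩ := h.descent
  obtain ⟨ρ, hρ, hball⟩ := Metric.isOpen_iff.mp hUo 1 h1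
  set σ := min ρ (1 / 4) with hσ
  have hσ0 : 0 < σ := by positivity
  have hc := h.jordan.continuous
  have hK : IsCompact (Icc (0 : ℝ) 1 ∩ {t | σ ≤ ‖γ t - 1‖}) :=
    isCompact_Icc.inter_right (isClosed_le (by fun_prop) (by fun_prop))
  have hne : ∀ t ∈ Icc (0 : ℝ) 1 ∩ {t | σ ≤ ‖γ t - 1‖}, 0 < ‖γ t - 1‖ :=
    fun t ht => hσ0.trans_le ht.2
  obtain ⟨c, hc0, hcK⟩ := hK.exists_forall_le'
    (f := fun t => -potential (γ t) / ‖γ t - 1‖ ^ 2) (a := 0)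
    (ContinuousOn.div h.continuous_potential.neg.continuousOn (by fun_prop)
      fun t ht => (pow_pos (hne t ht) 2).ne') fun t ht => by
      refine div_pos (neg_pos.mpr (h.potential_neg fun h1 => ?_)) (pow_pos (hne t ht) 2)
      have := hne t ht
      rw [h1] at this
      simp at this
  refine ⟨min c (1 / 4), by positivity, fun t => ?_⟩
  rw [← h.jordan.periodic.apply_fract t]
  set u := Int.fract t
  have hu : u ∈ Icc (0 : ℝ) 1 := ⟨Int.fract_nonneg _, (Int.fract_lt_one _).le⟩
  have hsq := sq_nonneg ‖γ u - 1‖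
  rcases lt_or_ge ‖γ u - 1‖ σ with hlt | hge
  · have hmem : γ u ∈ steepestDescentPath ∩ U := by
      rw [← hU]
      refine ⟨mem_range_self u, hball ?_⟩
      rw [Metric.mem_ball, dist_eq_norm]
      exact hlt.trans_le (min_le_left _ _)
    have h2 := potential_le_of_mem_steepestDescentPath hmem.1 (hlt.le.trans (min_le_right _ _))
    have h3 := mul_le_mul_of_nonneg_right (min_le_right c (1 / 4)) hsq
    linarith
  · have h2 := hcK u ⟨hu, hge⟩
    rw [le_div_iff₀ (pow_pos (hne u ⟨hu, hge⟩) 2)] at h2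
    have h3 := mul_le_mul_of_nonneg_right (min_le_left c (1 / 4)) hsq
    linarith

end IsAdmissible

/-! ### Bounds for the Cauchy integral, uniform up to the contour. -/

/-- The integral of `1 / (s - z)` along an arc whose tangent stays in a half plane. -/
theorem norm_integral_inv_sub_mul_deriv_le {γ : ℝ → ℂ} (hγ : IsSmoothJordanCurve γ) {a b : ℝ}
    (hab : a ≤ b) {u z : ℂ} (hu : ∀ t ∈ Icc a b, 0 < (starRingEnd ℂ u * deriv γ t).re)
    (hz : ∀ t ∈ Icc a b, γ t ≠ z) :
    ‖∫ t in a..b, (γ t - z)⁻¹ * deriv γ t‖ ≤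
      |Real.log ‖γ b - z‖ - Real.log ‖γ a - z‖| + 2 * Real.pi := by
  set f : ℝ → ℂ := fun t => starRingEnd ℂ u * (γ t - z) with hf
  have hu0 : starRingEnd ℂ u ≠ 0 := by
    intro h0
    have := hu a (left_mem_Icc.mpr hab)
    rw [h0] at this
    simp at this
  have hfd : ∀ t, HasDerivAt f (starRingEnd ℂ u * deriv γ t) t := fun t =>
    ((hγ.hasDerivAt t).sub_const z).const_mul _
  have hre : ∀ t, HasDerivAt (fun t => (f t).re) (starRingEnd ℂ u * deriv γ t).re t := fun t => by
    have := (Complex.reCLM.hasFDerivAt (x := f t)).comp_hasDerivAt t (hfd t)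
    exact this
  have hrec : Continuous fun t => (f t).re :=
    continuous_iff_continuousAt.mpr fun t => (hre t).continuousAt
  have hmono : StrictMonoOn (fun t => (f t).re) (Icc a b) := by
    refine strictMonoOn_of_deriv_pos (convex_Icc a b) hrec.continuousOn fun t ht => ?_
    rw [(hre t).deriv]
    exact hu t (interior_subset ht)
  have hf0 : ∀ t ∈ Icc a b, f t ≠ 0 := fun t ht =>
    mul_ne_zero hu0 (sub_ne_zero.mpr (hz t ht))
  -- The real part of `f` increases strictly, so `f` meets the imaginary axis at most once and
  -- misses some closed half-axis. A rotation by `v` moves that half-axis onto the cut, and the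
  -- principal logarithm becomes a primitive.
  obtain ⟨v, hv, hslit⟩ : ∃ v : ℂ, ‖v‖ = 1 ∧ ∀ t ∈ Icc a b, v * f t ∈ slitPlane := by
    by_cases h1 : 0 < (f a).re
    · refine ⟨1, norm_one, fun t ht => Or.inl ?_⟩
      rw [one_mul]
      exact h1.trans_le (hmono.monotoneOn (left_mem_Icc.mpr hab) ht ht.1)
    by_cases h2 : (f b).re < 0
    · refine ⟨-1, by simp, fun t ht => Or.inl ?_⟩
      have : (f t).re ≤ (f b).re := hmono.monotoneOn ht (right_mem_Icc.mpr hab) ht.2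
      rw [neg_one_mul, Complex.neg_re]
      linarith
    obtain ⟨x, hx, hx0⟩ := intermediate_value_Icc hab hrec.continuousOn
      ⟨not_lt.mp h1, not_lt.mp h2⟩
    have hx0' : (f x).re = 0 := hx0
    have him : (f x).im ≠ 0 := fun h => hf0 x hx (Complex.ext hx0' h)
    have hne : ∀ t ∈ Icc a b, t ≠ x → (f t).re ≠ 0 := fun t ht htx h =>
      htx (hmono.injOn ht hx (h.trans hx0'.symm))
    rcases him.lt_or_gt with hneg | hpos
    · refine ⟨I, Complex.norm_I, fun t ht => ?_⟩
      by_cases htx : t = x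
      · left
        rw [htx]
        simpa using hneg
      · right
        simpa using hne t ht htx
    · refine ⟨-I, by simp, fun t ht => ?_⟩
      by_cases htx : t = x
      · left
        rw [htx]
        simpa using hpos
      · right
        simpa using hne t ht htx
  have hv0 : v ≠ 0 := norm_ne_zero_iff.mp (by rw [hv]; exact one_ne_zero)
  have hint : ∫ t in a..b, (γ t - z)⁻¹ * deriv γ t =
      Complex.log (v * f b) - Complex.log (v * f a) := by
    refine intervalIntegral.integral_eq_sub_of_hasDerivAt (f := fun t => Complex.log (v * f t))
      (fun t ht => ?_) ?_
    · rw [uIcc_of_le hab] at ht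
      refine (((hfd t).const_mul v).clog_real (hslit t ht)).congr_deriv ?_
      have := sub_ne_zero.mpr (hz t ht)
      simp only [hf]
      field_simp
    · refine ContinuousOn.intervalIntegrable (ContinuousOn.mul (ContinuousOn.inv₀ ?_ ?_) ?_)
      · exact (hγ.continuous.sub continuous_const).continuousOn
      · intro t ht
        rw [uIcc_of_le hab] at ht
        exact sub_ne_zero.mpr (hz t ht)
      · exact hγ.continuous_deriv.continuousOn
  have hlog : ∀ t ∈ Icc a b, Real.log ‖v * f t‖ =
      Real.log ‖starRingEnd ℂ u‖ + Real.log ‖γ t - z‖ := fun t ht => by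
    rw [norm_mul, hv, one_mul, norm_mul, Real.log_mul (norm_ne_zero_iff.mpr hu0)
      (norm_ne_zero_iff.mpr (sub_ne_zero.mpr (hz t ht)))]
  rw [hint]
  refine (Complex.norm_le_abs_re_add_abs_im _).trans (add_le_add (le_of_eq ?_) ?_)
  · rw [Complex.sub_re, Complex.log_re, Complex.log_re, hlog a (left_mem_Icc.mpr hab),
      hlog b (right_mem_Icc.mpr hab), add_sub_add_left_eq_sub]
  · rw [Complex.sub_im, Complex.log_im, Complex.log_im]
    have h1 := Complex.abs_arg_le_pi (v * f b)
    have h2 := Complex.abs_arg_le_pi (v * f a)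
    have h3 := abs_sub (v * f b).arg (v * f a).arg
    linarith

theorem exists_pow_mul_exp_neg_le (p : ℕ) {c : ℝ} (hc : 0 < c) :
    ∃ C, 0 < C ∧ ∀ x : ℝ, 0 ≤ x → x ^ p * Real.exp (-(c * x)) ≤ C := by
  refine ⟨p.factorial / c ^ p, by positivity, fun x hx => ?_⟩
  have h := Real.pow_div_factorial_le_exp (c * x) (by positivity) p
  rw [Real.exp_neg, ← div_eq_mul_inv, div_le_iff₀ (Real.exp_pos _)]
  calc x ^ p = p.factorial / c ^ p * ((c * x) ^ p / p.factorial) := by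
        have : (p.factorial : ℝ) ≠ 0 := by positivity
        rw [mul_pow]; field_simp
    _ ≤ _ := by gcongr

theorem exists_pow_mul_exp_neg_sq_le (p : ℕ) {c : ℝ} (hc : 0 < c) :
    ∃ C, 0 < C ∧ ∀ x : ℝ, 0 ≤ x → x ^ p * Real.exp (-(c * x ^ 2)) ≤ C := by
  obtain ⟨C, hC, h⟩ := exists_pow_mul_exp_neg_le p hc
  refine ⟨max C 1, by positivity, fun x hx => ?_⟩
  rcases le_total x 1 with h1 | h1
  · refine le_trans ?_ (le_max_right _ _)
    have h2 : Real.exp (-(c * x ^ 2)) ≤ 1 := Real.exp_le_one_iff.mpr (by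
      have : 0 ≤ c * x ^ 2 := by positivity
      linarith)
    exact mul_le_one₀ (pow_le_one₀ hx h1) (Real.exp_pos _).le h2
  · refine le_trans ?_ ((h (x ^ 2) (by positivity)).trans (le_max_left _ _))
    gcongr
    nlinarith

namespace IsAdmissible

variable {γ : ℝ → ℂ}

theorem norm_expPhase_le (h : IsAdmissible γ) :
    ∃ c, 0 < c ∧ ∀ n t, ‖expPhase n (γ t)‖ ≤ Real.exp (-(c * (n * ‖γ t - 1‖ ^ 2))) := by
  obtain ⟨c, hc, hp⟩ := h.exists_potential_le
  refine ⟨c, hc, fun n t => ?_⟩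
  rw [norm_expPhase n (h.winding.ne_zero t)]
  gcongr
  have := mul_le_mul_of_nonneg_left (hp t) (Nat.cast_nonneg (α := ℝ) n)
  linarith

/-- Half of the exponent absorbs `(n|s-1|²)^r`; the chord-arc bound turns the other half into a
Gaussian in the parameter, whose integral supplies the extra `1/√n`. -/
theorem integral_norm_expPhase_mul_le (h : IsAdmissible γ) (r : ℕ) :
    ∃ C, 0 < C ∧ ∀ n : ℕ, 1 ≤ n → ∀ s : ℝ,
      ∫ t in s..s + 1, ‖expPhase n (γ t)‖ * ‖γ t - 1‖ ^ (2 * r) ≤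
        C / Real.sqrt n ^ (2 * r + 1) := by
  obtain ⟨c, hc, hbound⟩ := h.norm_expPhase_le
  obtain ⟨c₁, hc₁, hchord⟩ := h.jordan.exists_chord_arc
  obtain ⟨t₀, ht₀⟩ := h.one_mem_range
  obtain ⟨A, hA, hpow⟩ := exists_pow_mul_exp_neg_le r (half_pos hc)
  set b := c / 2 * c₁ ^ 2 with hb
  have hb0 : 0 < b := by positivity
  refine ⟨A * Real.sqrt (Real.pi / b), by positivity, fun n hn s => ?_⟩
  have hn0 : (0 : ℝ) < n := by exact_mod_cast hn
  have hcont : Continuous fun t => ‖expPhase n (γ t)‖ * ‖γ t - 1‖ ^ (2 * r) := by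
    have h1 := continuous_expPhase_comp h.jordan h.winding n
    have h2 := h.jordan.continuous
    fun_prop
  have hper : Function.Periodic (fun t => ‖expPhase n (γ t)‖ * ‖γ t - 1‖ ^ (2 * r)) 1 :=
    fun t => by simp only [h.jordan.periodic t]
  rw [hper.intervalIntegral_add_eq s (t₀ - 1 / 2)]
  have hle : ∀ t ∈ Icc (t₀ - 1 / 2) (t₀ - 1 / 2 + 1),
      ‖expPhase n (γ t)‖ * ‖γ t - 1‖ ^ (2 * r) ≤
        A / n ^ r * Real.exp (-(n * b) * (t - t₀) ^ 2) := by
    intro t ht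
    have h1 := hchord t t₀ (abs_le.mpr ⟨by linarith [ht.1], by linarith [ht.2]⟩)
    rw [ht₀] at h1
    set x := ‖γ t - 1‖
    have h2 := hpow (n * x ^ 2) (by positivity)
    have h3 : Real.exp (-(c / 2 * (n * x ^ 2))) ≤ Real.exp (-(n * b) * (t - t₀) ^ 2) := by
      gcongr
      have h4 : (c₁ * |t - t₀|) ^ 2 ≤ x ^ 2 := by gcongr
      rw [mul_pow, sq_abs] at h4
      have h5 := mul_le_mul_of_nonneg_left h4 (show 0 ≤ c / 2 * n by positivity)
      rw [hb]
      linarith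
    calc ‖expPhase n (γ t)‖ * x ^ (2 * r)
        ≤ Real.exp (-(c * (n * x ^ 2))) * x ^ (2 * r) := by gcongr; exact hbound n t
      _ = ((n * x ^ 2) ^ r * Real.exp (-(c / 2 * (n * x ^ 2)))) / n ^ r *
          Real.exp (-(c / 2 * (n * x ^ 2))) := by
          rw [show -(c * (n * x ^ 2)) = -(c / 2 * (n * x ^ 2)) + -(c / 2 * (n * x ^ 2)) by ring,
            Real.exp_add, mul_pow, ← pow_mul]
          field_simp
      _ ≤ _ := by gcongr
  have hgi : MeasureTheory.Integrable fun t : ℝ =>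
      A / n ^ r * Real.exp (-(n * b) * (t - t₀) ^ 2) :=
    ((integrable_exp_neg_mul_sq (mul_pos hn0 hb0)).comp_sub_right t₀).const_mul _
  calc ∫ t in (t₀ - 1 / 2)..(t₀ - 1 / 2 + 1), ‖expPhase n (γ t)‖ * ‖γ t - 1‖ ^ (2 * r)
      ≤ ∫ t in (t₀ - 1 / 2)..(t₀ - 1 / 2 + 1),
          A / n ^ r * Real.exp (-(n * b) * (t - t₀) ^ 2) :=
        intervalIntegral.integral_mono_on (by linarith) (hcont.intervalIntegrable _ _)
          hgi.intervalIntegrable hle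
    _ ≤ ∫ t : ℝ, A / n ^ r * Real.exp (-(n * b) * (t - t₀) ^ 2) := by
        rw [intervalIntegral.integral_of_le (by linarith)]
        exact MeasureTheory.setIntegral_le_integral hgi
          (Filter.Eventually.of_forall fun t => by positivity)
    _ = A / n ^ r * Real.sqrt (Real.pi / (n * b)) := by
        rw [MeasureTheory.integral_const_mul, MeasureTheory.integral_sub_right_eq_self
          (fun t => Real.exp (-(n * b) * t ^ 2)) t₀, integral_gaussian]
    _ = A * Real.sqrt (Real.pi / b) / Real.sqrt n ^ (2 * r + 1) := by
        rw [mul_comm (n : ℝ) b, ← div_div, Real.sqrt_div (by positivity), pow_succ, pow_mul,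
          Real.sq_sqrt hn0.le]
        field_simp

end IsAdmissible

theorem IsSmoothJordanCurve.norm_sub_le_mul {γ : ℝ → ℂ} {M : ℝ} (h : IsSmoothJordanCurve γ) (hM : ∀ t, ‖deriv γ t‖ ≤ M)
    (t u : ℝ) : ‖γ t - γ u‖ ≤ M * |t - u| :=
  Convex.norm_image_sub_le_of_norm_hasDerivWithin_le (s := univ) (f := γ)
    (fun x _ => (h.hasDerivAt x).hasDerivWithinAt) (fun x _ => hM x) convex_univ
    (mem_univ u) (mem_univ t)

namespace IsAdmissible

variable {γ : ℝ → ℂ}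

/-- If `z` is close to `γ` relative to `d = |z-1|`, the decay on the contour persists on a disc of
radius comparable to `d`. The Gaussian in `√n d` then beats any power of `√n d`. -/
theorem exists_kernel_bound_near (h : IsAdmissible γ) (k : ℕ) :
    ∃ κ₀, 0 < κ₀ ∧ κ₀ ≤ 1 / 4 ∧ ∃ C, 0 < C ∧ ∀ κ, 0 < κ → κ ≤ κ₀ → ∀ n : ℕ, 1 ≤ n → ∀ z t₀,
      z ≠ 1 → ‖z - 1‖ ≤ 2 → ‖γ t₀ - z‖ ≤ κ * ‖z - 1‖ → ∀ ξ ∈ Metric.ball z (2 * κ * ‖z - 1‖),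
        ‖expPhase n ξ * (ξ - 1) ^ k‖ ≤ C / (Real.sqrt n ^ (k + 1) * ‖z - 1‖) ∧
        ∃ g', HasDerivAt (fun s => expPhase n s * (s - 1) ^ k) g' ξ ∧
          ‖g'‖ * ‖z - 1‖ ≤ C / (Real.sqrt n ^ (k + 1) * ‖z - 1‖) := by
  obtain ⟨c, hc, hpot⟩ := h.exists_potential_le
  obtain ⟨a, ha, hnorm⟩ := h.exists_le_norm
  obtain ⟨C₁, hC₁, hexp₁⟩ := exists_pow_mul_exp_neg_sq_le (k + 1) (show 0 < c / 4 by positivity)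
  obtain ⟨C₃, hC₃, hexp₃⟩ := exists_pow_mul_exp_neg_sq_le (k + 3) (show 0 < c / 4 by positivity)
  refine ⟨min (1 / 4) (min (a / 12) (c * a / 16)), by positivity, min_le_left _ _,
    2 ^ k * C₁ + (4 * 2 ^ k / a * C₃ + k * 2 ^ k * C₁), by positivity, ?_⟩
  intro κ hκ hκ₀ n hn z t₀ hz1 hz2 ht₀ ξ hξ
  have hκ1 : κ ≤ 1 / 4 := hκ₀.trans (min_le_left _ _)
  have hκ2 : κ ≤ a / 12 := hκ₀.trans ((min_le_right _ _).trans (min_le_left _ _))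
  have hκ3 : κ ≤ c * a / 16 := hκ₀.trans ((min_le_right _ _).trans (min_le_right _ _))
  set d := ‖z - 1‖ with hd
  have hd0 : 0 < d := norm_pos_iff.mpr (sub_ne_zero.mpr hz1)
  set s := γ t₀ with hs
  have hsa : a ≤ ‖s‖ := hnorm t₀
  have hs0 : s ≠ 0 := h.winding.ne_zero t₀
  rw [Metric.mem_ball, dist_eq_norm] at hξ
  have hκd : κ * d ≤ d / 4 := by nlinarith
  have hρ : ‖ξ - s‖ ≤ 3 * κ * d := by
    have := norm_sub_le_norm_sub_add_norm_sub ξ z s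
    rw [norm_sub_rev z s] at this
    linarith
  have hρa : ‖ξ - s‖ ≤ a / 2 := by nlinarith
  have hs1 : ‖s - 1‖ ≤ 5 / 4 * d := by
    have := norm_sub_le_norm_sub_add_norm_sub s z 1
    linarith
  have hs1' : 3 / 4 * d ≤ ‖s - 1‖ := by
    have := norm_sub_le_norm_sub_add_norm_sub z s 1
    rw [norm_sub_rev z s] at this
    linarith
  have hξ1 : ‖ξ - 1‖ ≤ 2 * d := by
    have := norm_sub_le_norm_sub_add_norm_sub ξ z 1
    linarith
  have hξa : a / 2 ≤ ‖ξ‖ := by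
    have := norm_sub_norm_le s ξ
    rw [norm_sub_rev] at this
    linarith
  have hξ0 : ξ ≠ 0 := norm_pos_iff.mp (by linarith)
  -- The nearby contour point gives `-(9/16) c d²`; the smallness of `κ` limits the Taylor loss to
  -- `(5/16) c d²`.
  have hpξ : potential ξ ≤ -(c / 4 * d ^ 2) := by
    have h1 := potential_le_add hs0 (ξ := ξ) (by linarith)
    have h2 : ‖ξ - s‖ * ‖s - 1‖ / ‖s‖ ≤ 3 * κ * d * (5 / 4 * d) / a := by gcongr
    have h3 : ‖ξ - s‖ ^ 2 / ‖s‖ ^ 2 ≤ (3 * κ * d) ^ 2 / a ^ 2 := by gcongr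
    have h4 := hpot t₀
    have h5 : (3 / 4 * d) ^ 2 ≤ ‖s - 1‖ ^ 2 := by gcongr
    have h6 : c * (3 / 4 * d) ^ 2 ≤ c * ‖s - 1‖ ^ 2 := by gcongr
    have hκa : κ / a ≤ c / 16 := by
      rw [div_le_iff₀ ha]
      linarith
    have hκa' : κ / a ≤ 1 / 12 := by
      rw [div_le_iff₀ ha]
      linarith
    have hκa0 : 0 ≤ κ / a := by positivity
    have h7 : 3 * κ * d * (5 / 4 * d) / a = 15 / 4 * (κ / a) * d ^ 2 := by field_simp; ring
    have h8 : (3 * κ * d) ^ 2 / a ^ 2 = 9 * (κ / a) ^ 2 * d ^ 2 := by field_simp; ring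
    have h9 : 15 / 4 * (κ / a) + 9 * (κ / a) ^ 2 ≤ 5 / 16 * c := by nlinarith
    have h10 := mul_le_mul_of_nonneg_right h9 (sq_nonneg d)
    rw [← hs] at h4
    rw [h7] at h2
    rw [h8] at h3
    linarith
  have hq0 : 0 < Real.sqrt n := Real.sqrt_pos.mpr (by exact_mod_cast hn)
  set q := Real.sqrt n with hq
  have hqn : (n : ℝ) = q ^ 2 := (Real.sq_sqrt (Nat.cast_nonneg n)).symm
  have hE : ‖expPhase n ξ‖ ≤ Real.exp (-(c / 4 * (q * d) ^ 2)) := by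
    rw [norm_expPhase n hξ0]
    gcongr
    rw [mul_pow, ← hqn]
    have := mul_le_mul_of_nonneg_left hpξ (Nat.cast_nonneg (α := ℝ) n)
    linarith
  set E := Real.exp (-(c / 4 * (q * d) ^ 2)) with hEdef
  have hE0 : 0 < E := Real.exp_pos _
  have e1 : (q * d) ^ (k + 1) * E ≤ C₁ := hexp₁ _ (by positivity)
  have e3 : (q * d) ^ (k + 3) * E ≤ C₃ := hexp₃ _ (by positivity)
  constructor
  · rw [le_div_iff₀ (by positivity), norm_mul, norm_pow]
    calc ‖expPhase n ξ‖ * ‖ξ - 1‖ ^ k * (q ^ (k + 1) * d)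
        ≤ E * (2 * d) ^ k * (q ^ (k + 1) * d) := by gcongr
      _ = 2 ^ k * ((q * d) ^ (k + 1) * E) := by rw [mul_pow, mul_pow]; ring
      _ ≤ 2 ^ k * C₁ := by gcongr
      _ ≤ _ := le_add_of_nonneg_right (by positivity)
  · have hder : HasDerivAt (fun s : ℂ => (s - 1) ^ k) (k * (ξ - 1) ^ (k - 1) * 1) ξ :=
      ((hasDerivAt_id ξ).sub_const 1).pow k
    refine ⟨_, (hasDerivAt_expPhase n hξ0).fun_mul hder, ?_⟩
    rw [le_div_iff₀ (by positivity)]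
    have hk : (k : ℝ) * ‖ξ - 1‖ ^ (k - 1) * d ≤ k * 2 ^ k * d ^ k := by
      rcases k with _ | k
      · simp
      · rw [Nat.add_sub_cancel]
        calc ((k + 1 : ℕ) : ℝ) * ‖ξ - 1‖ ^ k * d ≤ (k + 1 : ℕ) * (2 * d) ^ k * d := by gcongr
          _ = (k + 1 : ℕ) * 2 ^ k * d ^ (k + 1) := by rw [mul_pow]; ring
          _ ≤ (k + 1 : ℕ) * 2 ^ (k + 1) * d ^ (k + 1) := by
            gcongr <;> norm_num
    have hmul : ‖expPhase n ξ * (n * ((ξ - 1) / ξ)) * (ξ - 1) ^ k +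
        expPhase n ξ * (k * (ξ - 1) ^ (k - 1) * 1)‖ * d ≤
        E * (n * (2 * d / (a / 2)) * (2 * d) ^ k * d) + E * (k * 2 ^ k * d ^ k) := by
      have h1 : ‖expPhase n ξ * (n * ((ξ - 1) / ξ)) * (ξ - 1) ^ k‖ ≤
          E * (n * (2 * d / (a / 2))) * (2 * d) ^ k := by
        simp only [norm_mul, norm_div, norm_pow, Complex.norm_natCast]
        gcongr
      have h2 : ‖expPhase n ξ * (k * (ξ - 1) ^ (k - 1) * 1)‖ * d ≤ E * (k * 2 ^ k * d ^ k) := by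
        simp only [norm_mul, norm_pow, Complex.norm_natCast, mul_one]
        rw [mul_assoc]
        gcongr
      have h3 := mul_le_mul_of_nonneg_right (norm_add_le
        (expPhase n ξ * (n * ((ξ - 1) / ξ)) * (ξ - 1) ^ k)
        (expPhase n ξ * (k * (ξ - 1) ^ (k - 1) * 1))) hd0.le
      have h4 := mul_le_mul_of_nonneg_right h1 hd0.le
      linarith
    calc _ ≤ (E * (n * (2 * d / (a / 2)) * (2 * d) ^ k * d) + E * (k * 2 ^ k * d ^ k)) *
          (q ^ (k + 1) * d) := by gcongr
      _ = 4 * 2 ^ k / a * ((q * d) ^ (k + 3) * E) + k * 2 ^ k * ((q * d) ^ (k + 1) * E) := by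
          rw [hqn, mul_pow, mul_pow, mul_pow]
          field_simp
          ring
      _ ≤ 4 * 2 ^ k / a * C₃ + k * 2 ^ k * C₁ := by gcongr
      _ ≤ _ := le_add_of_nonneg_left (by positivity)

end IsAdmissible

/-- Subtracting the value at `z` bounds the Cauchy integral over a short arc close to `z`. -/
theorem norm_integral_near_le {γ : ℝ → ℂ} (h : IsSmoothJordanCurve γ) {g : ℂ → ℂ} {z u : ℂ}
    {a b κ d M K Λ : ℝ} (hab : a ≤ b) (hκd : 0 < κ * d) (hM : ∀ t, ‖deriv γ t‖ ≤ M)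
    (hK : 0 ≤ K) (hz : ∀ t, γ t ≠ z) (hgc : Continuous fun t => g (γ t))
    (hg : ∀ ξ ∈ Metric.ball z (2 * κ * d), ‖g ξ‖ ≤ K ∧ ∃ g', HasDerivAt g g' ξ ∧ ‖g'‖ * d ≤ K)
    (hu : ∀ t ∈ Icc a b, 0 < (starRingEnd ℂ u * deriv γ t).re) (hd : 0 < d)
    (hΛ : |Real.log ‖γ b - z‖ - Real.log ‖γ a - z‖| ≤ Λ) :
    ‖∫ t in a..b, g (γ t) / (γ t - z) * deriv γ t‖ ≤
      (∫ t in a..b, M / (κ * d) * ‖g (γ t)‖) + (b - a) * (M * K / d * (1 + 1 / κ)) +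
        K * (Λ + 2 * Real.pi) := by
  have hκ : 0 < κ := pos_of_mul_pos_left hκd hd.le
  have hM0 : 0 ≤ M := (norm_nonneg _).trans (hM 0)
  have hzb : z ∈ Metric.ball z (2 * κ * d) := Metric.mem_ball_self (by linarith)
  have hz0 : ∀ t, γ t - z ≠ 0 := fun t => sub_ne_zero.mpr (hz t)
  have hinv : Continuous fun t => (γ t - z)⁻¹ := (h.continuous.sub continuous_const).inv₀ hz0
  have hder := h.continuous_deriv
  have hgn : Continuous fun t => M / (κ * d) * ‖g (γ t)‖ := continuous_const.mul hgc.norm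
  have hi₁ : Continuous fun t => (g (γ t) - g z) * (γ t - z)⁻¹ * deriv γ t :=
    ((hgc.sub continuous_const).mul hinv).mul hder
  have hi₂ : Continuous fun t => g z * ((γ t - z)⁻¹ * deriv γ t) :=
    continuous_const.mul (hinv.mul hder)
  have hsplit : ∫ t in a..b, g (γ t) / (γ t - z) * deriv γ t =
      (∫ t in a..b, (g (γ t) - g z) * (γ t - z)⁻¹ * deriv γ t) +
        g z * ∫ t in a..b, (γ t - z)⁻¹ * deriv γ t := by
    rw [← intervalIntegral.integral_const_mul, ← intervalIntegral.integral_add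
      (hi₁.intervalIntegrable _ _) (hi₂.intervalIntegrable _ _)]
    refine intervalIntegral.integral_congr fun t _ => ?_
    simp only [div_eq_mul_inv]
    ring
  have hpt : ∀ t, ‖(g (γ t) - g z) * (γ t - z)⁻¹ * deriv γ t‖ ≤
      M / (κ * d) * ‖g (γ t)‖ + M * K / d * (1 + 1 / κ) := by
    intro t
    have hpos : 0 < ‖γ t - z‖ := norm_pos_iff.mpr (hz0 t)
    rw [norm_mul, norm_mul, norm_inv]
    have hgz : ‖g z‖ ≤ K := (hg z hzb).1
    have key : ‖g (γ t) - g z‖ * ‖γ t - z‖⁻¹ ≤ ‖g (γ t)‖ / (κ * d) + K / d * (1 + 1 / κ) := by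
      -- Within the disc the mean value inequality bounds the difference quotient; outside it the
      -- denominator is at least `κ d`.
      rcases lt_or_ge ‖γ t - z‖ (2 * κ * d) with hlt | hge
      · have h1 : ‖g (γ t) - g z‖ ≤ K / d * ‖γ t - z‖ := by
          choose! g' hg' using fun ξ hξ => (hg ξ hξ).2
          refine Convex.norm_image_sub_le_of_norm_hasDerivWithin_le
            (fun ξ hξ => (hg' ξ hξ).1.hasDerivWithinAt) (fun ξ hξ => ?_)
            (convex_ball z (2 * κ * d)) hzb (by rwa [Metric.mem_ball, dist_eq_norm])
          rw [le_div_iff₀ hd]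
          exact (hg' ξ hξ).2
        have h2 : ‖g (γ t) - g z‖ * ‖γ t - z‖⁻¹ ≤ K / d := by
          rw [← div_eq_mul_inv, div_le_iff₀ hpos]
          exact h1
        have h3 : 0 ≤ ‖g (γ t)‖ / (κ * d) := by positivity
        have h4 : 0 ≤ K / d * (1 / κ) := by positivity
        linarith
      · have h1 : ‖γ t - z‖⁻¹ ≤ (κ * d)⁻¹ := by
          gcongr
          linarith
        calc ‖g (γ t) - g z‖ * ‖γ t - z‖⁻¹ ≤ (‖g (γ t)‖ + K) * (κ * d)⁻¹ := by
              gcongr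
              exact (norm_sub_le _ _).trans (by gcongr)
          _ = ‖g (γ t)‖ / (κ * d) + K / d * (1 / κ) := by field_simp
          _ ≤ _ := by
              have : 0 ≤ K / d := by positivity
              linarith
    calc ‖g (γ t) - g z‖ * ‖γ t - z‖⁻¹ * ‖deriv γ t‖
        ≤ (‖g (γ t)‖ / (κ * d) + K / d * (1 + 1 / κ)) * M := by
          gcongr
          exact hM t
      _ = _ := by ring
  rw [hsplit]
  refine (norm_add_le _ _).trans (add_le_add ?_ ?_)
  · calc ‖∫ t in a..b, (g (γ t) - g z) * (γ t - z)⁻¹ * deriv γ t‖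
        ≤ ∫ t in a..b, (M / (κ * d) * ‖g (γ t)‖ + M * K / d * (1 + 1 / κ)) :=
          intervalIntegral.norm_integral_le_of_norm_le hab
            (Filter.Eventually.of_forall fun t _ => hpt t)
            ((hgn.add continuous_const).intervalIntegrable _ _)
      _ = _ := by
          rw [intervalIntegral.integral_add (hgn.intervalIntegrable _ _) (by simp), intervalIntegral.integral_const, smul_eq_mul]
  · rw [norm_mul]
    have := norm_integral_inv_sub_mul_deriv_le h hab hu fun t _ => hz t
    have hgz : ‖g z‖ ≤ K := (hg z hzb).1
    gcongr
    linarith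

/-- The Cauchy integral over an arc that stays away from `z`. -/
theorem norm_integral_away_le {γ : ℝ → ℂ} {g : ℂ → ℂ} {z : ℂ} {a b e M : ℝ}
    (hab : a ≤ b) (he : 0 < e) (hM : ∀ t, ‖deriv γ t‖ ≤ M) (hgc : Continuous fun t => g (γ t))
    (hz : ∀ t ∈ Icc a b, e ≤ ‖γ t - z‖) :
    ‖∫ t in a..b, g (γ t) / (γ t - z) * deriv γ t‖ ≤ ∫ t in a..b, M / e * ‖g (γ t)‖ := by
  refine intervalIntegral.norm_integral_le_of_norm_le hab
    (Filter.Eventually.of_forall fun t ht => ?_)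
    ((continuous_const.mul hgc.norm).intervalIntegrable _ _)
  rw [norm_mul, norm_div]
  calc ‖g (γ t)‖ / ‖γ t - z‖ * ‖deriv γ t‖ ≤ ‖g (γ t)‖ / e * M := by
        gcongr
        · exact hz t (Ioc_subset_Icc_self ht)
        · exact hM t
    _ = _ := by ring

namespace IsAdmissible

variable {γ : ℝ → ℂ}

theorem norm_contourInt_remainder_le (h : IsAdmissible γ) (r : ℕ) :
    ∃ C, 0 < C ∧ ∀ n : ℕ, 1 ≤ n → ∀ z, z ∉ range γ → z ≠ 1 → ‖z - 1‖ ≤ 2 →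
      ‖contourInt γ (fun s => expPhase n s * (s - 1) ^ (2 * r) / (s - z))‖ ≤
        C / (Real.sqrt n ^ (2 * r + 1) * ‖z - 1‖) := by
  have hJ := h.jordan
  obtain ⟨m, hm, hm'⟩ := hJ.exists_le_norm_deriv
  obtain ⟨M, hM0, hM⟩ := hJ.exists_norm_deriv_le
  obtain ⟨l, hl, hl2, hl'⟩ := hJ.exists_modulus (half_pos hm)
  obtain ⟨c, hc, hchord⟩ := hJ.exists_chord_arc
  obtain ⟨G, hG, hGint⟩ := h.integral_norm_expPhase_mul_le r
  obtain ⟨κ₀, hκ₀, hκ₀4, B, hB, hnear⟩ := h.exists_kernel_bound_near (2 * r)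
  set κ := min κ₀ (c * l / 8) with hκ
  have hκ0 : 0 < κ := by positivity
  have hκ1 : κ ≤ κ₀ := min_le_left _ _
  have hκ2 : κ ≤ c * l / 8 := min_le_right _ _
  set Λ := Real.log (1 + 4 * M / c) with hΛ
  have hΛ0 : 0 ≤ Λ := Real.log_nonneg (by
    have : 0 ≤ 4 * M / c := by positivity
    linarith)
  refine ⟨M / κ * G + (8 * κ / c * M * (1 + 1 / κ) * B + B * (Λ + 2 * Real.pi)), by positivity,
    fun n hn z hzγ hz1 hz2 => ?_⟩
  set d := ‖z - 1‖ with hd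
  have hd0 : 0 < d := norm_pos_iff.mpr (sub_ne_zero.mpr hz1)
  have hq0 : 0 < Real.sqrt n := Real.sqrt_pos.mpr (by exact_mod_cast hn)
  set q := Real.sqrt n
  set g : ℂ → ℂ := fun s => expPhase n s * (s - 1) ^ (2 * r) with hg
  have hγc := hJ.continuous
  have hgc : Continuous fun t => g (γ t) :=
    (continuous_expPhase_comp hJ h.winding n).mul (by fun_prop)
  have hzne : ∀ t, γ t ≠ z := fun t ht => hzγ ⟨t, ht⟩
  have hz0 : ∀ t, γ t - z ≠ 0 := fun t => sub_ne_zero.mpr (hzne t)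
  have hκd : 0 < κ * d := by positivity
  have hGn : ∀ s : ℝ, ∫ t in s..s + 1, M / (κ * d) * ‖g (γ t)‖ ≤ M / κ * G / (q ^ (2 * r + 1) * d) := by
    intro s
    rw [intervalIntegral.integral_const_mul]
    simp_rw [hg, norm_mul, norm_pow]
    calc _ ≤ M / (κ * d) * (G / q ^ (2 * r + 1)) := by
          gcongr
          exact hGint n hn s
      _ = _ := by field_simp
  have hrest : 0 ≤ (8 * κ / c * M * (1 + 1 / κ) * B + B * (Λ + 2 * Real.pi)) /
      (q ^ (2 * r + 1) * d) := by positivity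
  rw [add_div, contourInt]
  change ‖∫ t in (0 : ℝ)..1, g (γ t) / (γ t - z) * deriv γ t‖ ≤ _
  by_cases hfar : ∀ t, κ * d ≤ ‖γ t - z‖
  · have h1 := norm_integral_away_le zero_le_one hκd hM hgc fun t _ => hfar t
    have h2 := hGn 0
    rw [zero_add] at h2
    linarith
  · push Not at hfar
    obtain ⟨t₀, ht₀⟩ := hfar
    -- By the chord-arc bound, leaving this parameter window moves the curve at least `4κd` from `γ
    -- t₀`, hence more than `κd` from `z`. The choice of `κ` and `d ≤ 2` give `L ≤ l`, so the
    -- tangent stays in a half plane inside the window.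
    set L := 4 * κ * d / c with hL
    have hL0 : 0 < L := by positivity
    have hLl : L ≤ l := by
      rw [hL, div_le_iff₀ hc]
      nlinarith
    have hcL : c * L = 4 * κ * d := by rw [hL]; field_simp
    have hper : Function.Periodic (fun t => g (γ t) / (γ t - z) * deriv γ t) 1 := fun t => by
      simp only [hJ.periodic t, hJ.periodic_deriv t]
    have hshift := hper.intervalIntegral_add_eq 0 (t₀ - 1 / 2)
    rw [zero_add] at hshift
    have hcont : Continuous fun t => g (γ t) / (γ t - z) * deriv γ t :=
      (hgc.div (hγc.sub continuous_const) hz0).mul hJ.continuous_deriv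
    have haway : ∀ t, |t - t₀| ≤ 1 / 2 → L ≤ |t - t₀| → κ * d ≤ ‖γ t - z‖ := by
      intro t h1 h2
      have h3 := hchord t t₀ h1
      have h4 : c * L ≤ c * |t - t₀| := by gcongr
      have h5 := norm_sub_le_norm_sub_add_norm_sub (γ t) z (γ t₀)
      rw [norm_sub_rev z] at h5
      linarith
    -- At both ends the distance to `z` lies between `κd` and `κd(1 + 4M/c)`, so the logarithms
    -- differ by a constant independent of `z`.
    have hend : ∀ t, |t - t₀| = L → |Real.log ‖γ t - z‖ - Real.log (κ * d)| ≤ Λ ∧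
        0 ≤ Real.log ‖γ t - z‖ - Real.log (κ * d) := by
      intro t ht
      have h1 := haway t (by linarith) ht.ge
      have h2 : ‖γ t - z‖ ≤ κ * d * (1 + 4 * M / c) := by
        have h3 := norm_sub_le_norm_sub_add_norm_sub (γ t) (γ t₀) z
        have h4 := hJ.norm_sub_le_mul hM t t₀
        rw [ht] at h4
        have h5 : M * L = κ * d * (4 * M / c) := by rw [hL]; field_simp
        linarith
      have h3 : 0 ≤ Real.log ‖γ t - z‖ - Real.log (κ * d) :=
        sub_nonneg.mpr (Real.log_le_log hκd h1)
      refine ⟨?_, h3⟩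
      rw [abs_of_nonneg h3, sub_le_iff_le_add', hΛ, ← Real.log_mul hκd.ne' (by positivity)]
      exact Real.log_le_log (by linarith) h2
    obtain ⟨hb1, hb2⟩ := hend (t₀ + L) (by rw [add_sub_cancel_left, abs_of_pos hL0])
    obtain ⟨ha1, ha2⟩ := hend (t₀ - L) (by rw [sub_sub_cancel_left, abs_neg, abs_of_pos hL0])
    have hΛ' : |Real.log ‖γ (t₀ + L) - z‖ - Real.log ‖γ (t₀ - L) - z‖| ≤ Λ := by
      rw [abs_of_nonneg hb2] at hb1
      rw [abs_of_nonneg ha2] at ha1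
      rw [abs_le]
      constructor <;> linarith
    have hu : ∀ t ∈ Icc (t₀ - L) (t₀ + L),
        0 < (starRingEnd ℂ (deriv γ t₀) * deriv γ t).re := by
      intro t ht
      have h1 := hl' t t₀ ((abs_le.mpr ⟨by linarith [ht.1], by linarith [ht.2]⟩ : |t - t₀| ≤ L).trans
        hLl)
      set v := deriv γ t₀
      have hv : m ≤ ‖v‖ := hm' t₀
      have h2 : starRingEnd ℂ v * deriv γ t =
          ((‖v‖ ^ 2 : ℝ) : ℂ) + starRingEnd ℂ v * (deriv γ t - v) := by
        rw [mul_sub, Complex.conj_mul']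
        push_cast
        ring
      have h3 := Complex.abs_re_le_norm (starRingEnd ℂ v * (deriv γ t - v))
      rw [norm_mul, Complex.norm_conj] at h3
      have h4 : ‖v‖ * ‖deriv γ t - v‖ ≤ ‖v‖ * (m / 2) := by gcongr
      have h5 := (abs_le.mp h3).1
      rw [h2, Complex.add_re, Complex.ofReal_re]
      nlinarith
    have hmid := norm_integral_near_le hJ (g := g) (z := z) (u := deriv γ t₀) (a := t₀ - L)
      (b := t₀ + L) (κ := κ) (d := d) (M := M) (K := B / (q ^ (2 * r + 1) * d)) (Λ := Λ)
      (by linarith) hκd hM (by positivity) hzne hgc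
      (hnear κ hκ0 hκ1 n hn z t₀ hz1 hz2 ht₀.le) hu hd0 hΛ'
    have hleft := norm_integral_away_le (g := g) (z := z) (a := t₀ - 1 / 2) (b := t₀ - L)
      (by linarith) hκd hM hgc fun t ht => by
        have h1 : |t - t₀| = t₀ - t := by rw [abs_of_nonpos (by linarith [ht.2])]; ring
        exact haway t (by linarith [ht.1]) (by linarith [ht.2])
    have hright := norm_integral_away_le (g := g) (z := z) (a := t₀ + L) (b := t₀ - 1 / 2 + 1)
      (by linarith) hκd hM hgc fun t ht => by
        have h1 : |t - t₀| = t - t₀ := abs_of_nonneg (by linarith [ht.1])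
        exact haway t (by linarith [ht.2]) (by linarith [ht.1])
    have hPint : ∀ a b : ℝ, IntervalIntegrable (fun t => M / (κ * d) * ‖g (γ t)‖)
        MeasureTheory.volume a b := fun a b =>
      (continuous_const.mul hgc.norm).intervalIntegrable a b
    have hadd := intervalIntegral.integral_add_adjacent_intervals
      (hcont.intervalIntegrable (t₀ - 1 / 2) (t₀ + L))
      (hcont.intervalIntegrable (t₀ + L) (t₀ - 1 / 2 + 1)) (μ := MeasureTheory.volume)
    have hadd1 := intervalIntegral.integral_add_adjacent_intervals (hcont.intervalIntegrable
      (t₀ - 1 / 2) (t₀ - L)) (hcont.intervalIntegrable (t₀ - L) (t₀ + L))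
      (μ := MeasureTheory.volume)
    have hP1 := intervalIntegral.integral_add_adjacent_intervals
      (hPint (t₀ - 1 / 2) (t₀ - L)) (hPint (t₀ - L) (t₀ + L))
    have hP2 := intervalIntegral.integral_add_adjacent_intervals
      (hPint (t₀ - 1 / 2) (t₀ + L)) (hPint (t₀ + L) (t₀ - 1 / 2 + 1))
    have hGs := hGn (t₀ - 1 / 2)
    rw [hshift, ← hadd, ← hadd1]
    refine (norm_add₃_le).trans ?_
    have hlen : (t₀ + L - (t₀ - L)) * (M * (B / (q ^ (2 * r + 1) * d)) / d * (1 + 1 / κ)) +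
        B / (q ^ (2 * r + 1) * d) * (Λ + 2 * Real.pi) =
        (8 * κ / c * M * (1 + 1 / κ) * B + B * (Λ + 2 * Real.pi)) / (q ^ (2 * r + 1) * d) := by
      rw [hL]
      field_simp
      ring
    linarith

end IsAdmissible

/-! ### Assembly of the expansion. -/

theorem inv_add_eq_sum {u v : ℂ} (hu : u ≠ 0) (huv : u + v ≠ 0) (N : ℕ) :
    (u + v)⁻¹ = ∑ m ∈ Finset.range N, (-1) ^ m * (u ^ (m + 1))⁻¹ * v ^ m +
      (-1) ^ N * (u ^ N)⁻¹ * (v ^ N / (u + v)) := by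
  induction N with
  | zero => simp
  | succ N ih =>
    rw [Finset.sum_range_succ, ih]
    field_simp
    ring

theorem cauchyF_eq {γ : ℝ → ℂ} (hγ : IsSmoothJordanCurve γ)
    (hw : WindsCounterclockwiseAroundZero γ) (n r : ℕ) {z : ℂ} (hz : z ∉ range γ) (hz1 : z ≠ 1) :
    cauchyF γ n z = (2 * (Real.pi : ℂ) * I)⁻¹ *
      (∑ m ∈ Finset.range (2 * r), (-1) ^ m * ((1 - z) ^ (m + 1))⁻¹ * contourMoment γ n m +
        ((1 - z) ^ (2 * r))⁻¹ *
          contourInt γ (fun s => expPhase n s * (s - 1) ^ (2 * r) / (s - z))) := by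
  have hu : 1 - z ≠ 0 := sub_ne_zero.mpr (Ne.symm hz1)
  have hc := hγ.continuous
  have hE := continuous_expPhase_comp hγ hw n
  have hz0 : ∀ t, γ t - z ≠ 0 := fun t => sub_ne_zero.mpr fun h => hz ⟨t, h⟩
  have hcont : ∀ m, Continuous fun t => expPhase n (γ t) * (γ t - 1) ^ m :=
    fun m => hE.mul (by fun_prop)
  rw [cauchyF, contourInt_congr (g := fun s => (∑ m ∈ Finset.range (2 * r),
    (-1) ^ m * ((1 - z) ^ (m + 1))⁻¹ * (expPhase n s * (s - 1) ^ m)) +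
      ((1 - z) ^ (2 * r))⁻¹ * (expPhase n s * (s - 1) ^ (2 * r) / (s - z))),
    contourInt_add hγ (f := fun s => ∑ m ∈ Finset.range (2 * r),
    (-1) ^ m * ((1 - z) ^ (m + 1))⁻¹ * (expPhase n s * (s - 1) ^ m))
    (g := fun s => ((1 - z) ^ (2 * r))⁻¹ * (expPhase n s * (s - 1) ^ (2 * r) / (s - z)))
    (continuous_finsetSum _ fun m _ => continuous_const.mul (hcont m))
    (continuous_const.mul ((hcont _).div (hc.sub continuous_const) hz0)),
    contourInt_sum hγ _ (f := fun m s => (-1) ^ m * ((1 - z) ^ (m + 1))⁻¹ *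
      (expPhase n s * (s - 1) ^ m)) (fun m _ => continuous_const.mul (hcont m)),
    contourInt_const_mul]
  · simp_rw [contourInt_const_mul]
    rfl
  · intro t
    have e := inv_add_eq_sum hu (v := γ t - 1)
      (by rw [show 1 - z + (γ t - 1) = γ t - z by ring]; exact hz0 t) (2 * r)
    rw [show 1 - z + (γ t - 1) = γ t - z by ring] at e
    change expPhase n (γ t) / (γ t - z) = _
    rw [div_eq_mul_inv, e, mul_add, Finset.mul_sum, Even.neg_one_pow (by simp : Even (2 * r))]
    congr 1
    · exact Finset.sum_congr rfl fun m _ => by ring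
    · ring

/-- The uniform expansion from which both parts of the theorem follow. -/
theorem IsAdmissible.exists_expansion {γ : ℝ → ℂ} (h : IsAdmissible γ) {r : ℕ} (hr : 1 ≤ r) :
    ∃ C : ℝ, 0 < C ∧ ∃ N : ℕ, ∀ n : ℕ, 1 ≤ n → N ≤ n → ∀ z : ℂ, z ∉ range γ → z ≠ 1 →
      ‖z - 1‖ ≤ 2 → ∃ E : ℂ, cauchyF γ n z = expansion expansionPoly r n z E ∧
        ‖E‖ ≤ C / ((n : ℝ) ^ r * ‖1 - z‖ ^ (2 * r)) := by
  obtain ⟨B, hB, hrem⟩ := h.norm_contourInt_remainder_le r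
  choose A hA hA' using fun m => (momentQuot_expansion m r).exists_pos
  obtain ⟨N, hN⟩ := Filter.eventually_atTop.mp ((Filter.eventually_all_finset
    (Finset.range (2 * r))).mpr fun m _ => (hA' m).bound)
  refine ⟨∑ m ∈ Finset.range (2 * r), 2 ^ (2 * r) * A m +
    Real.sqrt (2 * Real.pi) * (2 * Real.pi)⁻¹ * B, ?_, N, fun n hn hNn z hz hz1 hz2 => ?_⟩
  · have := Finset.sum_nonneg fun m (_ : m ∈ Finset.range (2 * r)) =>
      (mul_pos (show (0 : ℝ) < 2 ^ (2 * r) by positivity) (hA m)).le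
    positivity
  have hn0 : (0 : ℝ) < n := by exact_mod_cast hn
  have hu : 1 - z ≠ 0 := sub_ne_zero.mpr (Ne.symm hz1)
  have hR := hrem n hn z hz hz1 hz2
  rw [norm_sub_rev] at hz2 hR
  set R := contourInt γ (fun s => expPhase n s * (s - 1) ^ (2 * r) / (s - z))
  set u := 1 - z with hudef
  have hd0 : 0 < ‖u‖ := norm_pos_iff.mpr hu
  have hS0 : (Real.sqrt (2 * Real.pi * n) : ℂ) ≠ 0 := by
    have : 0 < Real.sqrt (2 * Real.pi * n) := by positivity
    exact_mod_cast this.ne'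
  set S := Real.sqrt (2 * Real.pi * n) with hS
  have hmain : S * u * cauchyF γ n z =
      ∑ m ∈ Finset.range (2 * r), (-1) ^ m * (u ^ m)⁻¹ * (momentQuot n m : ℂ) +
        S * u * ((2 * (Real.pi : ℂ) * I)⁻¹ * ((u ^ (2 * r))⁻¹ * R)) := by
    rw [cauchyF_eq h.jordan h.winding n r hz hz1, mul_add, mul_add, Finset.mul_sum, Finset.mul_sum]
    congr 1
    refine Finset.sum_congr rfl fun m _ => ?_
    rw [← sqrt_mul_contourMoment h.jordan h.winding (by lia) m, ← hS, ← hudef, pow_succ]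
    field_simp
  set P := 1 + ∑ j ∈ Finset.Ico 1 r,
    (expansionPoly j).eval z / ((n : ℂ) ^ j * (z - 1) ^ (2 * j)) with hP
  have hPsum : P = ∑ m ∈ Finset.range (2 * r), (-1) ^ m * (u ^ m)⁻¹ *
      ∑ j ∈ Finset.range r, (momentCoeff m j : ℂ) * (1 / (n : ℂ)) ^ j :=
    (sum_momentCoeff_eq hr n hz1).symm
  -- The error is forced by solving for `E`; it consists of the truncation errors of the moments and
  -- the remainder integral.
  refine ⟨S * u * cauchyF γ n z - P, ?_, ?_⟩
  · rw [expansion, ← hP, add_sub_cancel, ← hudef, ← hS]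
    field_simp
  · have hE : S * u * cauchyF γ n z - P = ∑ m ∈ Finset.range (2 * r), (-1) ^ m * (u ^ m)⁻¹ *
        ((momentQuot n m - ∑ j ∈ Finset.range r, momentCoeff m j * (1 / (n : ℝ)) ^ j : ℝ) : ℂ) +
        S * u * ((2 * (Real.pi : ℂ) * I)⁻¹ * ((u ^ (2 * r))⁻¹ * R)) := by
      rw [hmain, hPsum, add_sub_right_comm, ← Finset.sum_sub_distrib]
      congr 1
      refine Finset.sum_congr rfl fun m _ => ?_
      push_cast
      ring
    rw [hE, add_div, Finset.sum_div]
    refine (norm_add_le _ _).trans (add_le_add ((norm_sum_le _ _).trans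
      (Finset.sum_le_sum fun m hm => ?_)) ?_)
    · have hm' : m ≤ 2 * r := (Finset.mem_range.mp hm).le
      have h1 := hN n hNn m hm
      rw [Real.norm_of_nonneg (show 0 ≤ (1 / (n : ℝ)) ^ r by positivity)] at h1
      rw [norm_mul, norm_mul, norm_pow, norm_neg, norm_one, one_pow, one_mul, norm_inv, norm_pow,
        Complex.norm_real]
      -- Since `|u| ≤ 2`, lower negative powers of `|u|` are bounded by a constant times the power
      -- `-2r`.
      have h2 : (‖u‖ ^ m)⁻¹ ≤ 2 ^ (2 * r) / ‖u‖ ^ (2 * r) := by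
        rw [le_div_iff₀ (by positivity), ← Nat.sub_add_cancel hm', pow_add ‖u‖, mul_comm,
          mul_inv_cancel_right₀ (by positivity), Nat.sub_add_cancel hm']
        calc ‖u‖ ^ (2 * r - m) ≤ 2 ^ (2 * r - m) := by gcongr
          _ ≤ 2 ^ (2 * r) := pow_le_pow_right₀ (by norm_num) (Nat.sub_le _ _)
      calc _ ≤ 2 ^ (2 * r) / ‖u‖ ^ (2 * r) * (A m * (1 / (n : ℝ)) ^ r) := by gcongr
        _ = _ := by rw [one_div_pow]; field_simp
    · have hpi : ‖(2 * (Real.pi : ℂ) * I)⁻¹‖ = (2 * Real.pi)⁻¹ := by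
        rw [norm_inv, norm_mul, norm_mul, Complex.norm_I, Complex.norm_real,
          Real.norm_of_nonneg Real.pi_pos.le, Complex.norm_ofNat, mul_one]
      have hSn : ‖(S : ℂ)‖ = Real.sqrt (2 * Real.pi) * Real.sqrt n := by
        rw [Complex.norm_real, Real.norm_of_nonneg (Real.sqrt_nonneg _),
          Real.sqrt_mul (by positivity)]
      have hq : (n : ℝ) ^ r = Real.sqrt n ^ (2 * r) := by rw [pow_mul, Real.sq_sqrt hn0.le]
      have hq0 : 0 < Real.sqrt n := Real.sqrt_pos.mpr hn0
      rw [norm_mul, norm_mul, norm_mul, norm_mul, hpi, hSn, norm_inv, norm_pow, hq]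
      calc _ ≤ Real.sqrt (2 * Real.pi) * Real.sqrt n * ‖u‖ * ((2 * Real.pi)⁻¹ *
            ((‖u‖ ^ (2 * r))⁻¹ * (B / (Real.sqrt n ^ (2 * r + 1) * ‖u‖)))) := by gcongr
        _ = _ := by rw [pow_succ]; field_simp

theorem mainTheorem3 :
    ∃ h : ℕ → Polynomial ℂ,
      (∀ j : ℕ, 1 ≤ j → (h j).natDegree = 2 * j) ∧
      h 1 = Polynomial.C (-(1 / 12) : ℂ) *
        (Polynomial.X ^ 2 + Polynomial.C 10 * Polynomial.X + 1) ∧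
      ∀ γ : ℝ → ℂ, IsAdmissible γ → ∀ r : ℕ, 1 ≤ r →
        (∀ ε : ℝ, 0 < ε →
          ∃ C : ℝ, ∃ N : ℕ, ∀ n : ℕ, 1 ≤ n → N ≤ n → ∀ z : ℂ, z ∉ Set.range γ →
            ε ≤ ‖z - 1‖ → ‖z - 1‖ ≤ 2 →
              ∃ E : ℂ, cauchyF γ n z = expansion h r n z E ∧ ‖E‖ ≤ C / (n : ℝ) ^ r) ∧
        (∀ α : ℝ, 0 < α → α < 1 / 2 →
          ∃ C : ℝ, ∃ N : ℕ, ∀ n : ℕ, 1 ≤ n → N ≤ n → ∀ z : ℂ, z ∉ Set.range γ →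
            (n : ℝ) ^ (-α) ≤ ‖z - 1‖ → ‖z - 1‖ ≤ 2 →
              ∃ E : ℂ, cauchyF γ n z = expansion h r n z E ∧
                ‖E‖ ≤ C / ((n : ℝ) ^ r * ‖1 - z‖ ^ (2 * r))) := by
  refine ⟨expansionPoly, fun j _ => natDegree_expansionPoly j, expansionPoly_one,
    fun γ hγ r hr => ?_⟩
  obtain ⟨C, hC, N, hN⟩ := hγ.exists_expansion hr
  have hne : ∀ {x : ℝ} {z : ℂ}, 0 < x → x ≤ ‖z - 1‖ → z ≠ 1 := fun hx hxz hz => by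
    rw [hz, sub_self, norm_zero] at hxz
    linarith
  refine ⟨fun ε hε => ⟨C / ε ^ (2 * r), N, fun n hn hNn z hz hzε hz2 => ?_⟩,
    fun α _ _ => ⟨C, N, fun n hn hNn z hz hzα hz2 =>
      hN n hn hNn z hz (hne (Real.rpow_pos_of_pos (by exact_mod_cast hn) _) hzα) hz2⟩⟩
  obtain ⟨E, hE, hEn⟩ := hN n hn hNn z hz (hne hε hzε) hz2
  refine ⟨E, hE, hEn.trans ?_⟩
  have hn0 : (0 : ℝ) < n := by exact_mod_cast hn
  rw [norm_sub_rev, div_div, mul_comm (ε ^ (2 * r))]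
  gcongr
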